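/- \textbf{Setting.} Let $\Gamma'_1,\dots,\Gamma'_8$ be the standard octonionic generators of $C\ell_8$ ($(\Gamma'_i)^2=-1$) on its irreducible real module $S=\mathbb R^{16}$, $\Gamma'_9=\Gamma'_1\cdots\Gamma'_8$, and let $\Delta=S\oplus S=\mathbb R^{32}$ be the $C\ell_{1,10}$-module with (as $2\times 2$ block matrices) $$\Gamma_0=\begin{pmatrix}0&-\Gamma'_9\\ \Gamma'_9&0\end{pmatrix},\quad \Gamma_i=\begin{pmatrix}0&-\Gamma'_i\\ \Gamma'_i&0\end{pmatrix}\ (1\le i\le 8),\quad \Gamma_9=\begin{pmatrix}0&1\\1&0\end{pmatrix},\quad \Gamma_\natural=\begin{pmatrix}1&0\\0&-1\end{pmatrix}.$$ Let $e_0,\dots,e_9,e_\natural$ be the standard basis of Minkowski space $\mathbb M^{10,1}$ ($e_0$ timelike), $e_\pm=e_0\pm e_9$, $\Gamma_+=\Gamma_0+\Gamma_9$, and $\mathbb E^8=\mathrm{span}(e_1,\dots,e_8)$. Oriented planes are unit simple multivectors; they act on spinors by Clifford multiplication, and the spin groups act on them through $\mathrm{Spin}\to SO$. For a $(5,1)$-plane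 $\pi$ in $\mathbb M^{10,1}$ put $\Delta(\pi)=\{\varepsilon\in\Delta:\pi\cdot\varepsilon=\varepsilon\}$; for a $4$-plane $\zeta$ in $\mathbb E^8$ put $S(\zeta)=\{\varphi\in S:\zeta\cdot\varphi=\varphi\}$. A superscript $G$ or $K$ denotes invariants. For $0\ne\varphi\in S$ let $\Omega_\varphi(x_1,\dots,x_4)=\langle\varphi,(x_1\wedge\dots\wedge x_4)\cdot\varphi\rangle/\langle\varphi,\varphi\rangle$, a $4$-form on $\mathbb E^8$ (a Cayley form if $\varphi$ is chiral); $\zeta$ is calibrated by $\Omega_\varphi$ if $\Omega_\varphi$ has comass at most $1$ and $\Omega_\varphi(\zeta)=1$. A family of planes is \emph{$G$-related} if its members lie in one $G$-orbit and do not lie in one orbit of any proper subgroup of $G$. Let $0\neq\psi\in S$ have negative chirality ($\Gamma'_9\psi=-\psi$), let $\mathrm{Spin}_7\subset\mathrm{Spin}_8$ be its isotropy group, and let $\mathbb R^9\subset\mathrm{Spin}_{10,1}$ be the group of null rotations $1+\tfrac12\,c\,e_+$, $c\in\mathrm{span}(e_1,\dots,e_8,e_\natural)$. Let $G=K\ltimes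 N$ with $K\subset\mathrm{Spin}_7$, $N\subset\mathbb R^9$ and $N$ nontrivial. \textbf{Claim.} (1) $\Delta^N=\Delta':=\ker\Gamma_+$ is $16$-dimensional, and $j:S\to\Delta$, $j(\varphi)=\bigl(\tfrac12(1-\Gamma'_9)\varphi,\ \tfrac12(1+\Gamma'_9)\varphi\bigr)$, is a linear isomorphism of $S$ onto $\Delta'$, which is $C\ell_8$-linear when $x\in\mathbb E^8$ acts on $\Delta$ as the Clifford product $x\,e_\natural$ (so it is in particular $\mathrm{Spin}_8$-equivariant). (2) For every oriented $4$-plane $\zeta$ in $\mathbb E^8$, $\pi_\zeta:=-\tfrac12\,e_+\wedge e_-\wedge\zeta=e_0\wedge e_9\wedge\zeta$ is a $(5,1)$-plane, and $\Delta^G\cap\Delta(\pi_\zeta)=j\bigl(S^K\cap S(\zeta)\bigr)$. (3) For every oriented $4$-plane $\zeta$ in $\mathbb E^8$ and $0\ne\varphi\in S$: $\zeta\cdot\varphi=\varphi$ if and only if $\zeta$ is calibrated by $\Omega_\varphi$. (4) Let $(p_i)$ be a family of multivectors in one $G$-orbit, one of which is $p_{i_0}=\pi_\zeta$. Then all $p_i$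 are $(5,1)$-planes, $\Delta^G\cap\Delta(\pi_\zeta)\subset\bigcap_i\Delta(p_i)$, and there are $r_i\in N$ and $4$-planes $\zeta_i$ in $\mathbb E^8$ in one $K$-orbit, $\zeta_{i_0}=\zeta$, with $p_i=r_i\cdot\pi_{\zeta_i}$ for all $i$, such that every $\zeta_i$ is calibrated by $\Omega_\varphi$ for every nonzero $\varphi\in S^K\cap S(\zeta)$, and such that $(\zeta_i)$ is $K$-related if $(p_i)$ is $G$-related. If $\Delta^G\cap\Delta(\pi_\zeta)\neq0$, then $S^K\cap S(\zeta)$ contains a nonzero chiral spinor. Conversely, if $4$-planes $\zeta_i$ lie in one $K$-orbit and $r_i\in N$, then the planes $r_i\cdot\pi_{\zeta_i}$ lie in one $G$-orbit. (5) Let $(p_i)$ be a family in one $G$-orbit such that some member $p_{i_0}$ is a $(5,1)$-plane (not assumed to be of the form $\pi_\zeta$) with $(\psi,0)\in\Delta(p_{i_0})$. Then there are $r_i\in\mathbb R^9$ and $4$-planes $\zeta_i$ in $\mathbb E^8$ in one $K$-orbit, all calibrated by the Cayley form $\Omega_\psi$, with $p_i=r_i\cdot\pi_{\zeta_i}$ for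 all $i$. -/

import Mathlib

open scoped BigOperators

noncomputable section

/-! ### General notions: multivectors, the Clifford action, the spin group action -/

/-- An explicit inverse of `2` in `ℝ`, needed for the canonical isomorphism between Clifford
algebra and exterior algebra. -/
instance invertibleTwoReal : Invertible (2 : ℝ) := invertibleOfNonzero two_ne_zero

section General

variable {V : Type*} [AddCommGroup V] [Module ℝ V]

/-- The Clifford element of a multivector, through the canonical (quantisation) isomorphism
`⋀ V ≃ Cl(V, Q)`; it sends `v₁ ∧ ⋯ ∧ vₖ` to `v₁ ⋯ vₖ` when the `vᵢ` are mutually orthogonal. -/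
def toCliff (Q : QuadraticForm ℝ V) : ExteriorAlgebra ℝ V ≃ₗ[ℝ] CliffordAlgebra Q :=
  (CliffordAlgebra.equivExterior Q).symm

theorem contractLeft_prod_eq_zero (Q : QuadraticForm ℝ V) (d : Module.Dual ℝ V) :
    ∀ {m : ℕ} (v : Fin m → V), (∀ i, d (v i) = 0) →
      CliffordAlgebra.contractLeft d (List.ofFn fun i => CliffordAlgebra.ι Q (v i)).prod = 0
  | 0, v, _ => by simp
  | m + 1, v, h => by
    rw [List.ofFn_succ, List.prod_cons, CliffordAlgebra.contractLeft_ι_mul, h 0, zero_smul,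
      contractLeft_prod_eq_zero Q d (fun i => v i.succ) fun i => h i.succ, mul_zero, sub_zero]

theorem equivExterior_prod (Q : QuadraticForm ℝ V) :
    ∀ {m : ℕ} (v : Fin m → V), (∀ i j, i ≠ j → QuadraticMap.polar Q (v i) (v j) = 0) →
      CliffordAlgebra.equivExterior Q (List.ofFn fun i => CliffordAlgebra.ι Q (v i)).prod =
        ExteriorAlgebra.ιMulti ℝ m v
  | 0, v, _ => by
    rw [ExteriorAlgebra.ιMulti_zero_apply, List.ofFn_zero, List.prod_nil]
    exact CliffordAlgebra.changeForm_one CliffordAlgebra.changeForm.associated_neg_proof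
  | m + 1, v, h => by
    have ih := equivExterior_prod Q (fun i => v i.succ)
      fun i j hij => h i.succ j.succ fun e => hij (Fin.succ_injective _ e)
    have key : CliffordAlgebra.equivExterior Q (CliffordAlgebra.ι Q (v 0) *
        (List.ofFn fun i : Fin m => CliffordAlgebra.ι Q (v i.succ)).prod) = _ :=
      CliffordAlgebra.changeForm_ι_mul
        (CliffordAlgebra.changeForm.associated_neg_proof (Q := Q)) (v 0)
        (List.ofFn fun i : Fin m => CliffordAlgebra.ι Q (v i.succ)).prod
    have hdef : ∀ x, CliffordAlgebra.changeForm
        (CliffordAlgebra.changeForm.associated_neg_proof (Q := Q)) x =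
          CliffordAlgebra.equivExterior Q x := fun _ => rfl
    rw [List.ofFn_succ, List.prod_cons, key, hdef, ih, ExteriorAlgebra.ιMulti_apply,
      ExteriorAlgebra.ιMulti_apply, List.ofFn_succ, List.prod_cons]
    refine sub_eq_self.2 (contractLeft_prod_eq_zero 0 _ (fun i => v i.succ) fun i => ?_)
    have hp := h 0 i.succ (Fin.succ_ne_zero i).symm
    rw [QuadraticMap.associated_apply]
    simp only [QuadraticMap.polar, _root_.neg_apply] at hp ⊢
    rw [show -Q (v 0 + v i.succ) - -Q (v 0) - -Q (v i.succ) =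
      -(Q (v 0 + v i.succ) - Q (v 0) - Q (v i.succ)) by ring, hp, neg_zero, smul_zero]

/-- The Clifford element of a wedge product of mutually orthogonal vectors is their product. -/
theorem toCliff_ιMulti (Q : QuadraticForm ℝ V) {m : ℕ} (v : Fin m → V)
    (h : ∀ i j, i ≠ j → QuadraticMap.polar Q (v i) (v j) = 0) :
    toCliff Q (ExteriorAlgebra.ιMulti ℝ m v) =
      (List.ofFn fun i => CliffordAlgebra.ι Q (v i)).prod := by
  rw [toCliff, LinearEquiv.symm_apply_eq, equivExterior_prod Q v h]

/-- The action of `Spin(Q)` on multivectors that is induced by the covering `Spin(Q) → SO(Q)`: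
on the Clifford algebra it is conjugation, `x ↦ g x g⁻¹`. -/
def spinAct (Q : QuadraticForm ℝ V) (g : spinGroup Q) (p : ExteriorAlgebra ℝ V) :
    ExteriorAlgebra ℝ V :=
  (toCliff Q).symm ((g : CliffordAlgebra Q) * toCliff Q p * ((g⁻¹ : spinGroup Q) :
    CliffordAlgebra Q))

/-- All members of the family `p` lie in one and the same `G`-orbit. -/
def SameOrbit (Q : QuadraticForm ℝ V) {ι : Type*} (G : Subgroup (spinGroup Q))
    (p : ι → ExteriorAlgebra ℝ V) : Prop :=
  ∀ i j, ∃ g ∈ G, spinAct Q g (p i) = p j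

/-- The family `p` is `G`-related: its members lie in one `G`-orbit, and they do not lie in one
orbit of any smaller subgroup. -/
def Related (Q : QuadraticForm ℝ V) {ι : Type*} (G : Subgroup (spinGroup Q))
    (p : ι → ExteriorAlgebra ℝ V) : Prop :=
  SameOrbit Q G p ∧ ∀ G' : Subgroup (spinGroup Q), G' ≤ G → SameOrbit Q G' p → G' = G

variable {n : Type*} [Fintype n] [DecidableEq n]

/-- The subspace of spinors that are invariant under the subgroup `G` of the spin group, where the
spinors are a module over the Clifford algebra through `ρ`. -/
def invariants {Q : QuadraticForm ℝ V} (ρ : CliffordAlgebra Q →ₐ[ℝ] Matrix n n ℝ)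
    (G : Subgroup (spinGroup Q)) : Submodule ℝ (n → ℝ) where
  carrier := {ε | ∀ g ∈ G, (ρ (g : CliffordAlgebra Q)).mulVec ε = ε}
  add_mem' := by
    intro a b ha hb g hg
    rw [Matrix.mulVec_add, ha g hg, hb g hg]
  zero_mem' := by
    intro g _
    rw [Matrix.mulVec_zero]
  smul_mem' := by
    intro c a ha g hg
    rw [Matrix.mulVec_smul, ha g hg]

/-- The subspace of the spinors `ε` with `p · ε = ε`, for a multivector `p`. -/
def susy {Q : QuadraticForm ℝ V} (ρ : CliffordAlgebra Q →ₐ[ℝ] Matrix n n ℝ)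
    (p : ExteriorAlgebra ℝ V) : Submodule ℝ (n → ℝ) where
  carrier := {ε | (ρ (toCliff Q p)).mulVec ε = ε}
  add_mem' := by
    intro a b ha hb
    simp only [Set.mem_ofPred_eq] at *
    rw [Matrix.mulVec_add, ha, hb]
  zero_mem' := by
    simp only [Set.mem_ofPred_eq]
    rw [Matrix.mulVec_zero]
  smul_mem' := by
    intro c a ha
    simp only [Set.mem_ofPred_eq] at *
    rw [Matrix.mulVec_smul, ha]

/-- The isotropy subgroup of a spinor in the spin group. -/
def spinorStabilizer {Q : QuadraticForm ℝ V} (ρ : CliffordAlgebra Q →ₐ[ℝ] Matrix n n ℝ)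
    (ψ : n → ℝ) : Subgroup (spinGroup Q) where
  carrier := {g | (ρ (g : CliffordAlgebra Q)).mulVec ψ = ψ}
  one_mem' := by
    simp
  mul_mem' := by
    intro a b ha hb
    simp only [Set.mem_ofPred_eq] at *
    rw [Submonoid.coe_mul, map_mul, ← Matrix.mulVec_mulVec, hb, ha]
  inv_mem' := by
    intro a ha
    simp only [Set.mem_ofPred_eq] at *
    conv_lhs => rw [← ha]
    rw [Matrix.mulVec_mulVec, ← map_mul, ← Submonoid.coe_mul, inv_mul_cancel,
      Submonoid.coe_one, map_one, Matrix.one_mulVec]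

end General

/-- `G = K ⋉ N` as an internal semidirect product. -/
def IsSemidirect {A : Type*} [Group A] (K N G : Subgroup A) : Prop :=
  K ⊔ N = G ∧ K ⊓ N = ⊥ ∧ ∀ k ∈ K, ∀ x ∈ N, k * x * k⁻¹ ∈ N

/-- Clifford relations for a family of generators give the Clifford relation for all vectors. -/
theorem clifford_sq {m : ℕ} {A : Type*} [Ring A] [Algebra ℝ A] (γ : Fin m → A) (w : Fin m → ℝ)
    (h : ∀ i j, γ i * γ j + γ j * γ i = algebraMap ℝ A (if i = j then 2 * w i else 0))
    (v : Fin m → ℝ) :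
    Fintype.linearCombination ℝ γ v * Fintype.linearCombination ℝ γ v =
      algebraMap ℝ A (QuadraticMap.weightedSumSquares ℝ w v) := by
  have key : (2 : ℝ) • (Fintype.linearCombination ℝ γ v * Fintype.linearCombination ℝ γ v) =
      (2 : ℝ) • algebraMap ℝ A (QuadraticMap.weightedSumSquares ℝ w v) := by
    rw [two_smul]
    simp only [Fintype.linearCombination_apply, Finset.sum_mul_sum]
    nth_rewrite 2 [Finset.sum_comm]
    rw [← Finset.sum_add_distrib]
    simp only [← Finset.sum_add_distrib]
    have : ∀ i j, v i • γ i * v j • γ j + v j • γ j * v i • γ i =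
        algebraMap ℝ A (v i * v j * (if i = j then 2 * w i else 0)) := by
      intro i j
      rw [smul_mul_smul_comm, smul_mul_smul_comm, mul_comm (v j), ← smul_add, h,
        Algebra.smul_def, ← map_mul]
    simp only [this]
    rw [QuadraticMap.weightedSumSquares_apply, Algebra.smul_def, ← map_mul, Finset.mul_sum, map_sum]
    refine Finset.sum_congr rfl fun i _ => ?_
    rw [← map_sum]
    congr 1
    simp
    ring
  exact smul_right_injective A (two_ne_zero (α := ℝ)) key

/-! ### Eight dimensions: octonions, the Clifford algebra `Cl₈` and its spinor module -/

/-- Signs of the octonion multiplication table: the octonion units `o₀ = 1, o₁, …, o₇` multiply as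
`oᵢ oⱼ = octSign i j • o_{i xor j}`. -/
def octSign : Fin 8 → Fin 8 → ℤ :=
  ![![1, 1, 1, 1, 1, 1, 1, 1],
    ![1, -1, 1, -1, 1, -1, -1, 1],
    ![1, -1, -1, 1, 1, 1, -1, -1],
    ![1, 1, -1, -1, 1, -1, 1, -1],
    ![1, -1, -1, -1, -1, 1, 1, 1],
    ![1, 1, -1, 1, -1, -1, -1, 1],
    ![1, 1, 1, -1, -1, 1, -1, -1],
    ![1, -1, 1, 1, -1, -1, 1, -1]]

/-- The integer matrix of left multiplication by the imaginary octonion unit `o_{i+1}`. -/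
def octLeftInt (i : Fin 7) : Matrix (Fin 8) (Fin 8) ℤ :=
  Matrix.of fun k j => if k = i.succ ^^^ j then octSign i.succ j else 0

/-- Left multiplication by the imaginary octonion unit `o_{i+1}` on `𝕆 = ℝ⁸`. -/
def octLeft (i : Fin 7) : Matrix (Fin 8) (Fin 8) ℝ :=
  (octLeftInt i).map (Int.cast : ℤ → ℝ)

/-- The index set of the sixteen components of a `Cl₈` spinor. -/
abbrev Idx16 : Type := Fin 8 ⊕ Fin 8

/-- The generators of `Cl₈` on its irreducible real module `ℝ¹⁶`. -/
def gamma8 : Fin 8 → Matrix Idx16 Idx16 ℝ :=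
  Fin.snoc (α := fun _ => Matrix Idx16 Idx16 ℝ)
    (fun i : Fin 7 => Matrix.fromBlocks 0 (octLeft i) (octLeft i) 0)
    (Matrix.fromBlocks 0 (-1) 1 0)

/-- The product of the eight generators of `Cl₈`, the chirality operator. -/
def chir8 : Matrix Idx16 Idx16 ℝ := (List.ofFn gamma8).prod

/-- The quadratic form of `Cl₈`: minus the square of the euclidean norm of `𝔼⁸`. -/
def quad8 : QuadraticForm ℝ (Fin 8 → ℝ) := QuadraticMap.weightedSumSquares ℝ fun _ => (-1 : ℝ)

theorem octLeftInt_rel : ∀ i j : Fin 7, octLeftInt i * octLeftInt j + octLeftInt j * octLeftInt i =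
    if i = j then -2 else 0 := by
  decide +kernel

theorem octLeft_rel (i j : Fin 7) : octLeft i * octLeft j + octLeft j * octLeft i =
    algebraMap ℝ _ (if i = j then -2 else 0) := by
  have h := congrArg (fun M : Matrix (Fin 8) (Fin 8) ℤ => (Int.castRingHom ℝ).mapMatrix M)
    (octLeftInt_rel i j)
  simp only [map_add, map_mul] at h
  have h2 : ∀ i, (Int.castRingHom ℝ).mapMatrix (octLeftInt i) = octLeft i := fun i => rfl
  rw [h2, h2] at h
  rw [h]
  split_ifs
  · rw [map_neg, map_neg]
    simp only [map_ofNat]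
  · simp

theorem gamma8_castSucc (i : Fin 7) :
    gamma8 i.castSucc = Matrix.fromBlocks 0 (octLeft i) (octLeft i) 0 := by
  simp [gamma8]

theorem gamma8_last : gamma8 (Fin.last 7) = Matrix.fromBlocks 0 (-1) 1 0 := by
  exact Fin.snoc_last (α := fun _ => Matrix Idx16 Idx16 ℝ) _ _

theorem algebraMap_fromBlocks {n : Type*} [Fintype n] [DecidableEq n] (r : ℝ) :
    algebraMap ℝ (Matrix (n ⊕ n) (n ⊕ n) ℝ) r =
      Matrix.fromBlocks (algebraMap ℝ _ r) 0 0 (algebraMap ℝ _ r) := by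
  rw [Algebra.algebraMap_eq_smul_one, Algebra.algebraMap_eq_smul_one, ← Matrix.fromBlocks_one,
    Matrix.fromBlocks_smul]
  simp

theorem gamma8_rel (i j : Fin 8) : gamma8 i * gamma8 j + gamma8 j * gamma8 i =
    algebraMap ℝ _ (if i = j then 2 * (-1 : ℝ) else 0) := by
  rw [algebraMap_fromBlocks]
  induction i using Fin.lastCases with
  | last =>
    induction j using Fin.lastCases with
    | last =>
      rw [gamma8_last]
      simp [Matrix.fromBlocks_multiply, Matrix.fromBlocks_add, Algebra.algebraMap_eq_smul_one,
        ← neg_add, ← two_smul ℝ (1 : Matrix (Fin 8) (Fin 8) ℝ)]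
    | cast j =>
      rw [gamma8_last, gamma8_castSucc, if_neg (Fin.castSucc_lt_last j).ne']
      simp [Matrix.fromBlocks_multiply, Matrix.fromBlocks_add]
  | cast i =>
    induction j using Fin.lastCases with
    | last =>
      rw [gamma8_last, gamma8_castSucc, if_neg (Fin.castSucc_lt_last i).ne]
      simp [Matrix.fromBlocks_multiply, Matrix.fromBlocks_add]
    | cast j =>
      rw [gamma8_castSucc, gamma8_castSucc]
      simp only [Matrix.fromBlocks_multiply, Matrix.fromBlocks_add, octLeft_rel, zero_mul,
        mul_zero, add_zero, zero_add, Fin.castSucc_inj]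
      norm_num

/-- The spinor module of `Cl₈`. -/
def rho8 : CliffordAlgebra quad8 →ₐ[ℝ] Matrix Idx16 Idx16 ℝ :=
  CliffordAlgebra.lift quad8
    ⟨Fintype.linearCombination ℝ gamma8, clifford_sq gamma8 (fun _ => -1) gamma8_rel⟩

theorem octLeftInt_three : octLeftInt 0 * octLeftInt 1 * octLeftInt 2 =
    Matrix.diagonal ![-1, -1, -1, -1, 1, 1, 1, 1] := by
  decide +kernel

theorem octLeftInt_four : octLeftInt 3 * octLeftInt 4 * (octLeftInt 5 * octLeftInt 6) =
    Matrix.diagonal ![1, 1, 1, 1, -1, -1, -1, -1] := by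
  decide +kernel

/-- The product of the left multiplications by the seven imaginary units. -/
theorem octLeft_prod : octLeft 0 * octLeft 1 * octLeft 2 *
    (octLeft 3 * octLeft 4 * (octLeft 5 * octLeft 6)) = -1 := by
  have h : octLeftInt 0 * octLeftInt 1 * octLeftInt 2 *
      (octLeftInt 3 * octLeftInt 4 * (octLeftInt 5 * octLeftInt 6)) = -1 := by
    rw [octLeftInt_three, octLeftInt_four, Matrix.diagonal_mul_diagonal]
    decide +kernel
  have h1 := congrArg (fun M : Matrix (Fin 8) (Fin 8) ℤ => (Int.castRingHom ℝ).mapMatrix M) h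
  have h2 : ∀ i, (Int.castRingHom ℝ).mapMatrix (octLeftInt i) = octLeft i := fun i => rfl
  simpa only [map_mul, h2, map_neg, map_one] using h1

theorem chir8_eq : chir8 = Matrix.fromBlocks (-1) 0 0 1 := by
  have h := octLeft_prod
  simp only [mul_assoc] at h
  have e : chir8 = gamma8 (Fin.castSucc 0) * (gamma8 (Fin.castSucc 1) * (gamma8 (Fin.castSucc 2) *
      (gamma8 (Fin.castSucc 3) * (gamma8 (Fin.castSucc 4) * (gamma8 (Fin.castSucc 5) *
      (gamma8 (Fin.castSucc 6) * gamma8 (Fin.last 7))))))) := by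
    simp only [chir8, List.ofFn_succ, List.ofFn_zero, List.prod_cons, List.prod_nil, mul_one]
    rfl
  rw [e]
  simp only [gamma8_castSucc, gamma8_last, Matrix.fromBlocks_multiply, zero_mul, mul_zero,
    add_zero, zero_add, mul_one, mul_neg, neg_zero, h, neg_neg]

theorem chir8_sq : chir8 * chir8 = 1 := by
  rw [chir8_eq, Matrix.fromBlocks_multiply]
  simp

theorem chir8_anti (i : Fin 8) : chir8 * gamma8 i = -(gamma8 i * chir8) := by
  rw [chir8_eq]
  induction i using Fin.lastCases with
  | last =>
    rw [gamma8_last, Matrix.fromBlocks_multiply, Matrix.fromBlocks_multiply, Matrix.fromBlocks_neg]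
    simp
  | cast i =>
    rw [gamma8_castSucc, Matrix.fromBlocks_multiply, Matrix.fromBlocks_multiply,
      Matrix.fromBlocks_neg]
    simp

/-! ### Eleven dimensions: Minkowski space, `Cl₁,₁₀` and its spinor module `Δ` -/

/-- Minkowski space `𝕄¹⁰·¹`, with coordinates `0, 1, …, 9, ♮`; the index `♮` is `10`. -/
abbrev Mink : Type := Fin 11 → ℝ

/-- The diagonal entries `(-, +, …, +)` of the Minkowski metric. -/
def minkSign : Fin 11 → ℝ := Fin.cons (-1) fun _ => 1

/-- The Minkowski quadratic form. -/
def quad11 : QuadraticForm ℝ Mink := QuadraticMap.weightedSumSquares ℝ minkSign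

/-- The index set of the thirty-two components of a spinor in eleven dimensions. -/
abbrev Idx32 : Type := Idx16 ⊕ Idx16

/-- The gamma matrices `Γ₀, Γ₁, …, Γ₈, Γ₉, Γ_♮`. -/
def gamma11 : Fin 11 → Matrix Idx32 Idx32 ℝ :=
  Fin.cons (α := fun _ => Matrix Idx32 Idx32 ℝ) (Matrix.fromBlocks 0 (-chir8) chir8 0)
    (Fin.snoc (α := fun _ => Matrix Idx32 Idx32 ℝ)
      (Fin.snoc (α := fun _ => Matrix Idx32 Idx32 ℝ)
        (fun i : Fin 8 => Matrix.fromBlocks 0 (-gamma8 i) (gamma8 i) 0)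
        (Matrix.fromBlocks 0 1 1 0))
      (Matrix.fromBlocks 1 0 0 (-1)))

theorem gamma11_zero : gamma11 0 = Matrix.fromBlocks 0 (-chir8) chir8 0 := by
  simp [gamma11]

theorem gamma11_mid (i : Fin 8) :
    gamma11 i.castSucc.castSucc.succ = Matrix.fromBlocks 0 (-gamma8 i) (gamma8 i) 0 := by
  simp [gamma11]

theorem gamma11_nine : gamma11 (Fin.last 8).castSucc.succ = Matrix.fromBlocks 0 1 1 0 := by
  rw [gamma11, Fin.cons_succ, Fin.snoc_castSucc]
  exact Fin.snoc_last (α := fun _ => Matrix Idx32 Idx32 ℝ) _ _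

theorem gamma11_nat : gamma11 (Fin.last 9).succ = Matrix.fromBlocks 1 0 0 (-1) := by
  rw [gamma11, Fin.cons_succ]
  exact Fin.snoc_last (α := fun _ => Matrix Idx32 Idx32 ℝ) _ _

theorem index_cases (i : Fin 11) : i = 0 ∨ (∃ k : Fin 8, i = k.castSucc.castSucc.succ) ∨
    i = (Fin.last 8).castSucc.succ ∨ i = (Fin.last 9).succ := by
  induction i using Fin.cases with
  | zero => exact Or.inl rfl
  | succ i =>
    right
    induction i using Fin.lastCases with
    | last => exact Or.inr (Or.inr rfl)
    | cast i =>
      induction i using Fin.lastCases with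
      | last => exact Or.inr (Or.inl rfl)
      | cast i => exact Or.inl ⟨i, rfl⟩

theorem gamma11_sq (i : Fin 11) : gamma11 i * gamma11 i = algebraMap ℝ _ (minkSign i) := by
  have h8 : ∀ k, gamma8 k * gamma8 k = -1 := by
    intro k
    have h := gamma8_rel k k
    rw [if_pos rfl, ← two_smul ℝ, map_mul, ← Algebra.smul_def] at h
    have := smul_right_injective _ (two_ne_zero (α := ℝ)) h
    rw [this]
    simp
  rw [algebraMap_fromBlocks]
  rcases index_cases i with rfl | ⟨k, rfl⟩ | rfl | rfl
  · rw [gamma11_zero]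
    simp [minkSign, Matrix.fromBlocks_multiply, chir8_sq]
  · rw [gamma11_mid]
    simp [minkSign, Matrix.fromBlocks_multiply, h8]
  · rw [gamma11_nine]
    simp only [minkSign, Matrix.fromBlocks_multiply, Fin.cons_succ]
    simp
  · rw [gamma11_nat]
    simp only [minkSign, Matrix.fromBlocks_multiply, Fin.cons_succ]
    simp

theorem gamma11_anti (i j : Fin 11) (hij : i ≠ j) :
    gamma11 i * gamma11 j + gamma11 j * gamma11 i = 0 := by
  have h8 : ∀ k l, k ≠ l → gamma8 k * gamma8 l + gamma8 l * gamma8 k = 0 := by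
    intro k l hkl
    have h := gamma8_rel k l
    rwa [if_neg hkl, map_zero] at h
  rcases index_cases i with rfl | ⟨k, rfl⟩ | rfl | rfl <;>
  rcases index_cases j with rfl | ⟨l, rfl⟩ | rfl | rfl <;>
  first
  | exact absurd rfl hij
  | skip
  all_goals rw [show (0 : Matrix Idx32 Idx32 ℝ) = Matrix.fromBlocks 0 0 0 0 from
    Matrix.fromBlocks_zero.symm]
  all_goals simp only [gamma11_zero, gamma11_mid, gamma11_nine, gamma11_nat,
    Matrix.fromBlocks_multiply, Matrix.fromBlocks_add]
  all_goals simp only [zero_mul, mul_zero, zero_add, add_zero, one_mul, mul_one, neg_mul, mul_neg,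
    chir8_anti, neg_neg, neg_add_cancel, add_neg_cancel, neg_zero]
  have h := h8 k l (fun e => hij (by rw [e]))
  rw [← neg_add, h, neg_zero]

theorem gamma11_rel (i j : Fin 11) : gamma11 i * gamma11 j + gamma11 j * gamma11 i =
    algebraMap ℝ _ (if i = j then 2 * minkSign i else 0) := by
  split_ifs with h
  · subst h
    rw [gamma11_sq, ← two_smul ℝ, Algebra.smul_def, ← map_mul]
  · rw [gamma11_anti i j h, map_zero]

/-- The spinor representation `Δ` of `Cl₁,₁₀`, on `ℝ³²`. -/
def rho11 : CliffordAlgebra quad11 →ₐ[ℝ] Matrix Idx32 Idx32 ℝ :=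
  CliffordAlgebra.lift quad11
    ⟨Fintype.linearCombination ℝ gamma11, clifford_sq gamma11 minkSign gamma11_rel⟩

/-- The standard basis vector `e_M` of Minkowski space. -/
def stdVec (M : Fin 11) : Mink := Pi.single M 1

/-- The null vector `e₊ = e₀ + e₉`. -/
def ePlus : Mink := stdVec 0 + stdVec 9

/-- The null vector `e₋ = e₀ - e₉`. -/
def eMinus : Mink := stdVec 0 - stdVec 9

/-- The inclusion of `𝔼⁸` in Minkowski space, as the span of `e₁, …, e₈`. -/
def incl8 : (Fin 8 → ℝ) →ₗ[ℝ] Mink :=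
  Fintype.linearCombination ℝ fun i : Fin 8 => stdVec i.castSucc.castSucc.succ

/-- The Minkowski inner product. -/
def minkInner (x y : Mink) : ℝ := ∑ M, minkSign M * (x M * y M)

theorem quad11_apply (x : Mink) : quad11 x = minkInner x x := by
  simp [quad11, minkInner, QuadraticMap.weightedSumSquares_apply]

theorem polar_quad11 (x y : Mink) : QuadraticMap.polar quad11 x y = 2 * minkInner x y := by
  simp only [QuadraticMap.polar, quad11_apply, minkInner, Finset.mul_sum,
    ← Finset.sum_sub_distrib, Pi.add_apply]
  refine Finset.sum_congr rfl fun M _ => ?_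
  ring

theorem sum_eleven (f : Fin 11 → ℝ) :
    ∑ M, f M = f 0 + (∑ k : Fin 8, f k.castSucc.castSucc.succ) + f 9 + f 10 := by
  rw [Fin.sum_univ_succ, Fin.sum_univ_castSucc, Fin.sum_univ_castSucc]
  simp only [← add_assoc]
  rfl

theorem incl8_mid (x : Fin 8 → ℝ) (k : Fin 8) : incl8 x k.castSucc.castSucc.succ = x k := by
  simp [incl8, Fintype.linearCombination_apply, stdVec, Pi.single_apply]

theorem incl8_zero (x : Fin 8 → ℝ) : incl8 x 0 = 0 := by
  simp only [incl8, Fintype.linearCombination_apply, stdVec, Finset.sum_apply, Pi.smul_apply,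
    Pi.single_apply, smul_eq_mul]
  refine Finset.sum_eq_zero fun k _ => ?_
  rw [if_neg (Fin.succ_ne_zero _).symm, mul_zero]

theorem incl8_nine (x : Fin 8 → ℝ) : incl8 x 9 = 0 := by
  simp only [incl8, Fintype.linearCombination_apply, stdVec, Finset.sum_apply, Pi.smul_apply,
    Pi.single_apply, smul_eq_mul]
  refine Finset.sum_eq_zero fun k _ => ?_
  rw [if_neg, mul_zero]
  intro h
  have h1 := congrArg Fin.val h
  simp at h1
  omega

theorem incl8_nat (x : Fin 8 → ℝ) : incl8 x 10 = 0 := by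
  simp only [incl8, Fintype.linearCombination_apply, stdVec, Finset.sum_apply, Pi.smul_apply,
    Pi.single_apply, smul_eq_mul]
  refine Finset.sum_eq_zero fun k _ => ?_
  rw [if_neg, mul_zero]
  intro h
  have h1 := congrArg Fin.val h
  simp at h1
  omega

theorem quad11_incl8 (x : Fin 8 → ℝ) : quad11 (incl8 x) = -quad8 x := by
  have h8 : quad8 x = ∑ k, (-1 : ℝ) • (x k * x k) := QuadraticMap.weightedSumSquares_apply _ _
  rw [quad11_apply, minkInner, sum_eleven, h8, ← Finset.sum_neg_distrib]
  simp only [incl8_mid, incl8_zero, incl8_nine, incl8_nat, minkSign, Fin.cons_succ, mul_zero,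
    zero_add, add_zero]
  refine Finset.sum_congr rfl fun k _ => ?_
  simp

theorem minkInner_incl8_nat (x : Fin 8 → ℝ) : minkInner (incl8 x) (stdVec 10) = 0 := by
  rw [minkInner, Finset.sum_eq_single 10]
  · rw [incl8_nat, zero_mul, mul_zero]
  · intro b _ hb
    simp [stdVec, hb]
  · simp

theorem quad11_nat : quad11 (stdVec 10) = 1 := by
  rw [quad11_apply, minkInner, Finset.sum_eq_single 10]
  · rw [show (10 : Fin 11) = (Fin.last 9).succ from rfl]
    simp only [minkSign, Fin.cons_succ, stdVec, Pi.single_eq_same]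
    norm_num
  · intro b _ hb
    simp [stdVec, hb]
  · simp

theorem nat_sq : CliffordAlgebra.ι quad11 (stdVec 10) * CliffordAlgebra.ι quad11 (stdVec 10) = 1 := by
  rw [CliffordAlgebra.ι_sq_scalar, quad11_nat, map_one]

theorem incl8_nat_anti (x : Fin 8 → ℝ) :
    CliffordAlgebra.ι quad11 (stdVec 10) * CliffordAlgebra.ι quad11 (incl8 x) =
      -(CliffordAlgebra.ι quad11 (incl8 x) * CliffordAlgebra.ι quad11 (stdVec 10)) := by
  have h := CliffordAlgebra.ι_mul_ι_add_swap (Q := quad11) (incl8 x) (stdVec 10)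
  rw [polar_quad11, minkInner_incl8_nat, mul_zero, map_zero] at h
  exact eq_neg_of_add_eq_zero_right h

/-- The embedding `Cl₈ → Cl₁,₁₀` given on vectors of `𝔼⁸` by `x ↦ x e_♮`. On even elements it is the
natural embedding: for instance `x₁ ∧ x₂ ∧ x₃ ∧ x₄` goes to `x₁ ∧ x₂ ∧ x₃ ∧ x₄`. -/
def cliffEmb : CliffordAlgebra quad8 →ₐ[ℝ] CliffordAlgebra quad11 :=
  CliffordAlgebra.lift quad8
    ⟨LinearMap.mulRight ℝ (CliffordAlgebra.ι quad11 (stdVec 10)) ∘ₗ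
      CliffordAlgebra.ι quad11 ∘ₗ incl8, by
      intro x
      simp only [LinearMap.comp_apply, LinearMap.mulRight_apply]
      rw [mul_assoc, ← mul_assoc (CliffordAlgebra.ι quad11 (stdVec 10)), incl8_nat_anti, neg_mul,
        mul_assoc (CliffordAlgebra.ι quad11 (incl8 x)) _ (CliffordAlgebra.ι quad11 (stdVec 10)),
        nat_sq, mul_one, mul_neg, CliffordAlgebra.ι_sq_scalar, quad11_incl8, map_neg, neg_neg]⟩

theorem cliffEmb_ι (x : Fin 8 → ℝ) : cliffEmb (CliffordAlgebra.ι quad8 x) =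
    CliffordAlgebra.ι quad11 (incl8 x) * CliffordAlgebra.ι quad11 (stdVec 10) := by
  simp [cliffEmb]

theorem cliffEmb_star (x : CliffordAlgebra quad8) : cliffEmb (star x) = star (cliffEmb x) := by
  induction x using CliffordAlgebra.induction with
  | algebraMap r => simp [CliffordAlgebra.star_algebraMap]
  | ι x =>
    rw [CliffordAlgebra.star_ι, map_neg, cliffEmb_ι, star_mul, CliffordAlgebra.star_ι,
      CliffordAlgebra.star_ι, neg_mul_neg, incl8_nat_anti]
  | mul a b ha hb => rw [star_mul, map_mul, map_mul, star_mul, ha, hb]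
  | add a b ha hb => rw [star_add, map_add, map_add, star_add, ha, hb]

theorem cliffEmb_even (x : CliffordAlgebra quad8) : cliffEmb x ∈ CliffordAlgebra.even quad11 := by
  induction x using CliffordAlgebra.induction with
  | algebraMap r =>
    rw [AlgHom.commutes]
    exact Subalgebra.algebraMap_mem _ r
  | ι x =>
    rw [cliffEmb_ι]
    exact CliffordAlgebra.ι_mul_ι_mem_evenOdd_zero quad11 _ _
  | mul a b ha hb =>
    rw [map_mul]
    exact Subalgebra.mul_mem _ ha hb
  | add a b ha hb =>
    rw [map_add]
    exact Subalgebra.add_mem _ ha hb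

theorem cliffEmb_lipschitz (u : (CliffordAlgebra quad8)ˣ) (hu : u ∈ lipschitzGroup quad8) :
    Units.map (cliffEmb : CliffordAlgebra quad8 →* CliffordAlgebra quad11) u ∈
      lipschitzGroup quad11 := by
  let s : (CliffordAlgebra quad11)ˣ := ⟨_, _, nat_sq, nat_sq⟩
  have hs : s ∈ lipschitzGroup quad11 := Subgroup.subset_closure ⟨_, rfl⟩
  unfold lipschitzGroup at hu
  induction hu using Subgroup.closure_induction with
  | mem u hu =>
    obtain ⟨x, hx⟩ := hu
    have h : Units.map (cliffEmb : CliffordAlgebra quad8 →* CliffordAlgebra quad11) u * s ∈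
        lipschitzGroup quad11 := by
      refine Subgroup.subset_closure ⟨incl8 x, ?_⟩
      rw [Units.val_mul, Units.coe_map, ← hx]
      change _ = cliffEmb (CliffordAlgebra.ι quad8 x) * CliffordAlgebra.ι quad11 (stdVec 10)
      rw [cliffEmb_ι, mul_assoc, nat_sq, mul_one]
    exact (Subgroup.mul_mem_cancel_right _ hs).1 h
  | one => rw [map_one]; exact one_mem _
  | mul a b _ _ ha hb => rw [map_mul]; exact mul_mem ha hb
  | inv a _ ha => rw [map_inv]; exact inv_mem ha

theorem cliffEmb_spin (g : CliffordAlgebra quad8) (hg : g ∈ spinGroup quad8) :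
    cliffEmb g ∈ spinGroup quad11 := by
  refine ⟨⟨?_, ?_⟩, cliffEmb_even g⟩
  · obtain ⟨u, hu, rfl⟩ := hg.1.1
    exact ⟨_, cliffEmb_lipschitz u hu, rfl⟩
  · refine Unitary.mem_iff.2 ?_
    rw [← cliffEmb_star, ← map_mul, ← map_mul,
      spinGroup.star_mul_self_of_mem hg, spinGroup.mul_star_self_of_mem hg, map_one]
    exact ⟨rfl, rfl⟩

/-- The embedding `Spin₈ ⊂ Spin₁₀,₁` as the rotations of `𝔼⁸`. -/
def spinEmb : spinGroup quad8 →* spinGroup quad11 where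
  toFun g := ⟨cliffEmb g, cliffEmb_spin g g.2⟩
  map_one' := Subtype.ext (map_one cliffEmb)
  map_mul' a b := Subtype.ext (map_mul cliffEmb (a : CliffordAlgebra quad8) b)

/-- A product of two unit vectors (of positive square) lies in the spin group. -/
theorem mul_unit_mem_spin (a b : Mink) (ha : quad11 a = 1) (hb : quad11 b = 1) :
    CliffordAlgebra.ι quad11 a * CliffordAlgebra.ι quad11 b ∈ spinGroup quad11 := by
  have ha2 : CliffordAlgebra.ι quad11 a * CliffordAlgebra.ι quad11 a = 1 := by
    rw [CliffordAlgebra.ι_sq_scalar, ha, map_one]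
  have hb2 : CliffordAlgebra.ι quad11 b * CliffordAlgebra.ι quad11 b = 1 := by
    rw [CliffordAlgebra.ι_sq_scalar, hb, map_one]
  let u : (CliffordAlgebra quad11)ˣ := ⟨_, _, ha2, ha2⟩
  let v : (CliffordAlgebra quad11)ˣ := ⟨_, _, hb2, hb2⟩
  refine ⟨⟨⟨u * v, ?_, rfl⟩, ?_⟩, CliffordAlgebra.ι_mul_ι_mem_evenOdd_zero quad11 _ _⟩
  · exact mul_mem (Subgroup.subset_closure ⟨_, rfl⟩ : u ∈ lipschitzGroup quad11)
      (Subgroup.subset_closure ⟨_, rfl⟩ : v ∈ lipschitzGroup quad11)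
  · refine Unitary.mem_iff.2 ?_
    rw [star_mul, CliffordAlgebra.star_ι, CliffordAlgebra.star_ι, neg_mul_neg]
    constructor
    · rw [mul_assoc, ← mul_assoc (CliffordAlgebra.ι quad11 a), ha2, one_mul, hb2]
    · rw [mul_assoc, ← mul_assoc (CliffordAlgebra.ι quad11 b), hb2, one_mul, ha2]

theorem quad11_ePlus : quad11 ePlus = 0 := by
  rw [quad11_apply, minkInner, sum_eleven]
  have h9 : minkSign 9 = 1 := by
    rw [show (9 : Fin 11) = (Fin.last 8).castSucc.succ from rfl, minkSign, Fin.cons_succ]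
  have hk : ∀ k : Fin 8, ePlus k.castSucc.castSucc.succ = 0 := by
    intro k
    have h1 : k.castSucc.castSucc.succ ≠ (9 : Fin 11) := by
      intro h
      have h1 := congrArg Fin.val h
      simp at h1
      omega
    rw [ePlus, Pi.add_apply, stdVec, stdVec, Pi.single_eq_of_ne (Fin.succ_ne_zero _),
      Pi.single_eq_of_ne h1, add_zero]
  simp only [hk, h9]
  simp [ePlus, stdVec, minkSign]

theorem ePlus_sq : CliffordAlgebra.ι quad11 ePlus * CliffordAlgebra.ι quad11 ePlus = 0 := by
  rw [CliffordAlgebra.ι_sq_scalar, quad11_ePlus, map_zero]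

/-- A vector of Minkowski space lies in `𝔼⁹ = span {e₁, …, e₈, e_♮}`. -/
def InE9 (c : Mink) : Prop := c 0 = 0 ∧ c 9 = 0

theorem ePlus_anti (c : Mink) (hc : InE9 c) :
    CliffordAlgebra.ι quad11 ePlus * CliffordAlgebra.ι quad11 c =
      -(CliffordAlgebra.ι quad11 c * CliffordAlgebra.ι quad11 ePlus) := by
  have h := CliffordAlgebra.ι_mul_ι_add_swap (Q := quad11) c ePlus
  have h0 : minkInner c ePlus = 0 := by
    refine Finset.sum_eq_zero fun M _ => ?_
    by_cases h0 : M = 0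
    · rw [h0, hc.1, zero_mul, mul_zero]
    · by_cases h9 : M = 9
      · rw [h9, hc.2, zero_mul, mul_zero]
      · rw [ePlus, Pi.add_apply, stdVec, stdVec, Pi.single_eq_of_ne h0, Pi.single_eq_of_ne h9,
          add_zero, mul_zero, mul_zero]
  rw [polar_quad11, h0, mul_zero, map_zero] at h
  exact eq_neg_of_add_eq_zero_right h

/-- The null rotation `exp (½ c e₊) = 1 + ½ c e₊` in the Clifford algebra. -/
def nullRot (c : Mink) : CliffordAlgebra quad11 :=
  1 + (1 / 2 : ℝ) • (CliffordAlgebra.ι quad11 c * CliffordAlgebra.ι quad11 ePlus)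

theorem nullRot_mul (c d : Mink) (hd : InE9 d) :
    nullRot c * nullRot d = nullRot (c + d) := by
  have h : CliffordAlgebra.ι quad11 c * CliffordAlgebra.ι quad11 ePlus *
      (CliffordAlgebra.ι quad11 d * CliffordAlgebra.ι quad11 ePlus) = 0 := by
    rw [mul_assoc, ← mul_assoc (CliffordAlgebra.ι quad11 ePlus), ePlus_anti d hd, neg_mul,
      mul_assoc (CliffordAlgebra.ι quad11 d), ePlus_sq, mul_zero, neg_zero, mul_zero]
  simp only [nullRot, mul_add, add_mul, one_mul, mul_one, smul_mul_smul_comm, h, smul_zero,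
    map_add, smul_add, add_zero]
  rw [add_assoc]

theorem nullRot_zero : nullRot 0 = 1 := by
  simp [nullRot]

/-- Every null rotation is an element of `Spin₁₀,₁`. -/
theorem nullRot_mem (c : Mink) (hc : InE9 c) : nullRot c ∈ spinGroup quad11 := by
  by_cases h0 : c = 0
  · rw [h0, nullRot_zero]
    exact one_mem _
  have hq : quad11 c = ∑ M, c M * c M := by
    rw [quad11_apply]
    refine Finset.sum_congr rfl fun M _ => ?_
    induction M using Fin.cases with
    | zero => rw [hc.1, zero_mul, mul_zero]
    | succ M => rw [minkSign, Fin.cons_succ, one_mul]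
  have hpos : 0 < quad11 c := by
    rw [hq]
    obtain ⟨M, hM⟩ := Function.ne_iff.1 h0
    exact Finset.sum_pos' (fun i _ => mul_self_nonneg _)
      ⟨M, Finset.mem_univ _, mul_self_pos.2 hM⟩
  set r : ℝ := Real.sqrt (quad11 c) with hr
  have hr0 : r ≠ 0 := (Real.sqrt_pos.2 hpos).ne'
  have hrr : r * r = quad11 c := Real.mul_self_sqrt hpos.le
  have ha : quad11 (r⁻¹ • c) = 1 := by
    rw [QuadraticMap.map_smul, ← hrr, smul_eq_mul]
    field_simp
  have hp : QuadraticMap.polar quad11 (r⁻¹ • c) ((r / 2) • ePlus) = 0 := by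
    have h := CliffordAlgebra.ι_mul_ι_add_swap (Q := quad11) c ePlus
    rw [ePlus_anti c hc, add_neg_cancel] at h
    have h2 : QuadraticMap.polar quad11 c ePlus = 0 :=
      (algebraMap ℝ (CliffordAlgebra quad11)).injective (by rw [← h, map_zero])
    rw [QuadraticMap.polar_smul_left, QuadraticMap.polar_smul_right, h2, smul_zero, smul_zero]
  have hb : quad11 (r⁻¹ • c + (r / 2) • ePlus) = 1 := by
    rw [QuadraticMap.map_add quad11, ha, hp, QuadraticMap.map_smul, quad11_ePlus, smul_zero, add_zero,
      add_zero]
  have hm := mul_unit_mem_spin _ _ ha hb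
  rw [map_add, mul_add, CliffordAlgebra.ι_sq_scalar, ha, map_one, map_smul, map_smul,
    smul_mul_smul_comm] at hm
  have e : r⁻¹ * (r / 2) = 1 / 2 := by
    field_simp
  rwa [e] at hm

/-- The group `ℝ⁹ ⊂ Spin₁₀,₁` of null rotations fixing `e₊`. -/
def nullRotations : Subgroup (spinGroup quad11) where
  carrier := {g | ∃ c : Mink, InE9 c ∧ (g : CliffordAlgebra quad11) = nullRot c}
  one_mem' := ⟨0, ⟨rfl, rfl⟩, by rw [nullRot_zero]; rfl⟩
  mul_mem' := by
    rintro a b ⟨c, hc, ha⟩ ⟨d, hd, hb⟩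
    refine ⟨c + d, ⟨?_, ?_⟩, ?_⟩
    · rw [Pi.add_apply, hc.1, hd.1, add_zero]
    · rw [Pi.add_apply, hc.2, hd.2, add_zero]
    · rw [Submonoid.coe_mul, ha, hb, nullRot_mul c d hd]
  inv_mem' := by
    rintro a ⟨c, hc, ha⟩
    have hc' : InE9 (-c) := by
      refine ⟨?_, ?_⟩
      · rw [Pi.neg_apply, hc.1, neg_zero]
      · rw [Pi.neg_apply, hc.2, neg_zero]
    refine ⟨-c, hc', ?_⟩
    have h1 : (a : CliffordAlgebra quad11) * nullRot (-c) = 1 := by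
      rw [ha, nullRot_mul c (-c) hc', add_neg_cancel, nullRot_zero]
    have h2 : ((a⁻¹ : spinGroup quad11) : CliffordAlgebra quad11) * a = 1 := by
      rw [← Submonoid.coe_mul, inv_mul_cancel, Submonoid.coe_one]
    calc ((a⁻¹ : spinGroup quad11) : CliffordAlgebra quad11)
        = (a⁻¹ : spinGroup quad11) * ((a : CliffordAlgebra quad11) * nullRot (-c)) := by
          rw [h1, mul_one]
      _ = nullRot (-c) := by rw [← mul_assoc, h2, one_mul]

/-! ### Planes, Cayley forms, and the reduction -/

/-- An orthonormal quadruple of vectors in `𝔼⁸`. -/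
def IsFrame8 (w : Fin 4 → Fin 8 → ℝ) : Prop :=
  ∀ a b, ∑ i, w a i * w b i = if a = b then 1 else 0

/-- An oriented `4`-plane in `𝔼⁸`, as the unit simple `4`-vector `w₁ ∧ w₂ ∧ w₃ ∧ w₄`. -/
def IsPlane8 (ζ : ExteriorAlgebra ℝ (Fin 8 → ℝ)) : Prop :=
  ∃ w, IsFrame8 w ∧ ζ = ExteriorAlgebra.ιMulti ℝ 4 w

/-- An oriented `(5,1)`-plane in Minkowski space, as the unit simple `6`-vector
`v₀ ∧ v₁ ∧ ⋯ ∧ v₅` of an orthonormal basis with `v₀` timelike. (It is time-oriented by the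
time orientation of Minkowski space.) -/
def IsPlane51 (p : ExteriorAlgebra ℝ Mink) : Prop :=
  ∃ v : Fin 6 → Mink,
    (∀ a b, minkInner (v a) (v b) = if a = b then (if a = 0 then -1 else 1) else 0) ∧
      p = ExteriorAlgebra.ιMulti ℝ 6 v

/-- The `6`-vector `-½ e₊ ∧ e₋ ∧ ζ`, normalised so as to have unit norm if `ζ` has. -/
def brane (ζ : ExteriorAlgebra ℝ (Fin 8 → ℝ)) : ExteriorAlgebra ℝ Mink :=
  (-1 / 2 : ℝ) • (ExteriorAlgebra.ι ℝ ePlus * ExteriorAlgebra.ι ℝ eMinus *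
    ExteriorAlgebra.map incl8 ζ)

theorem brane_eq (ζ : ExteriorAlgebra ℝ (Fin 8 → ℝ)) :
    brane ζ = ExteriorAlgebra.ι ℝ (stdVec 0) * ExteriorAlgebra.ι ℝ (stdVec 9) *
      ExteriorAlgebra.map incl8 ζ := by
  have h := ExteriorAlgebra.ι_add_mul_swap (R := ℝ) (stdVec 0) (stdVec 9)
  have h' : ExteriorAlgebra.ι ℝ (stdVec 9) * ExteriorAlgebra.ι ℝ (stdVec 0) =
      -(ExteriorAlgebra.ι ℝ (stdVec 0) * ExteriorAlgebra.ι ℝ (stdVec 9)) :=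
    eq_neg_of_add_eq_zero_right h
  rw [brane, ePlus, eMinus, map_add, map_sub, add_mul, mul_sub, mul_sub,
    ExteriorAlgebra.ι_sq_zero, ExteriorAlgebra.ι_sq_zero, h', zero_sub, sub_zero, ← two_smul ℝ,
    ← smul_mul_assoc, smul_smul, smul_neg, ← neg_smul]
  norm_num

/-- The subspace `Δ'` of the spinors that are annihilated by `Γ₊`. -/
def deltaPrime : Submodule ℝ (Idx32 → ℝ) :=
  LinearMap.ker (Matrix.mulVecLin (rho11 (CliffordAlgebra.ι quad11 ePlus)))

/-- The map `φ = ψ₋ + χ₊ ↦ (ψ₋, χ₊)` from `Cl₈` spinors, decomposed into chiral components, to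
spinors in eleven dimensions. -/
def spinorIncl : (Idx16 → ℝ) →ₗ[ℝ] (Idx32 → ℝ) :=
  Matrix.mulVecLin (Matrix.fromRows ((1 / 2 : ℝ) • (1 - chir8)) ((1 / 2 : ℝ) • (1 + chir8)))

/-- The normalised `4`-form `Ω_φ (x₁, …, x₄) = ⟨φ, (x₁ ∧ x₂ ∧ x₃ ∧ x₄) · φ⟩ / ⟨φ, φ⟩` on `𝔼⁸` that
is built by squaring the spinor `φ`. For chiral `φ ≠ 0` it is a Cayley form. -/
def cayleyForm (φ : Idx16 → ℝ) : (Fin 8 → ℝ) [⋀^Fin 4]→ₗ[ℝ] ℝ :=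
  ({ toFun := fun p => (φ ⬝ᵥ φ)⁻¹ * (φ ⬝ᵥ (rho8 (toCliff quad8 p)).mulVec φ)
     map_add' := by
      intro p q
      rw [map_add, map_add, Matrix.add_mulVec, dotProduct_add, mul_add]
     map_smul' := by
      intro r p
      rw [map_smul, map_smul, Matrix.smul_mulVec, dotProduct_smul, RingHom.id_apply,
        smul_eq_mul, smul_eq_mul, mul_left_comm] } :
    ExteriorAlgebra ℝ (Fin 8 → ℝ) →ₗ[ℝ] ℝ).compAlternatingMap (ExteriorAlgebra.ιMulti ℝ 4)

/-- The `4`-form `Ω` has comass at most one, and `ζ` is an oriented `4`-plane on which `Ω` takes the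
value one; in other words, `ζ` is calibrated by `Ω`. -/
def IsCalibrated (Ω : (Fin 8 → ℝ) [⋀^Fin 4]→ₗ[ℝ] ℝ) (ζ : ExteriorAlgebra ℝ (Fin 8 → ℝ)) : Prop :=
  (∀ x, IsFrame8 x → Ω x ≤ 1) ∧
    ∃ w, IsFrame8 w ∧ ζ = ExteriorAlgebra.ιMulti ℝ 4 w ∧ Ω w = 1

end

noncomputable section

/-! ### Conjugation by the spin group on vectors, multivectors and preserved spinors -/

section General

variable {V : Type*} [AddCommGroup V] [Module ℝ V]

/-! A null rotation `1 + ½ c e₊` fixes `ε` exactly when `c e₊ ε = 0`. For `c ≠ 0` this means `e₊ ε =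
0`, because `c² = |c|² > 0` on the Euclidean space `𝔼⁹`. So one nontrivial element of `N` already
cuts `Δ` down to `ker Γ₊` (`invariants_eq_deltaPrime`). In blocks, `Γ₊` consists of twice the chiral
projectors, so its kernel is a copy of `S` (`range_spinorIncl`), on which `x e_♮` acts as `x` does
on `S` (`spinorIncl_mulVec`). On this kernel `e₀ e₉` is the identity (`zero_nine_mulVec`), so the
brane `π_ζ` acts there as `ζ`. This turns statements about `Δ` into statements about `S`.

Calibration is the equality case of Cauchy–Schwarz: a unit 4-plane acts orthogonally on `S`, so `|φ
− ζφ|² = 2|φ|² − 2⟨φ, ζφ⟩` (`dotProduct_sub_frame`).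

For orbits, write `g = x k` with `x ∈ N`, `k ∈ K`. Since `k` commutes with `e₀` and `e₉`, it carries
`π_ζ` to `π_{kζ}` (`brane_spinAct`). If the reduced family lay in an orbit of `K' < K`, the original
one would lie in an orbit of the join of `K'` and `N`, which is smaller than `G`
(`IsSemidirect.eq_of_sup_eq`). This last step needs `Spin₈ → Spin₁₀,₁` to be injective, which
follows from a faithful action on `Cl₈ ⊕ Cl₈`.

For an arbitrary plane preserving `ε = (ψ, 0)`, the tool is `mulVec_sum_eq_zero`: vectors in a plane
of even dimension anticommute with it and orthogonal vectors commute with it, so if `ε` is an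
eigenvector of a vector and of the plane, then the tangential part of the vector annihilates `ε`.
Applied to `e₊`, this leaves a null normal part orthogonal to a timelike vector, hence zero, so the
plane contains `e₊` and a null rotation brings it to the form `e₀ ∧ e₉ ∧ x₁ ∧ ⋯ ∧ x₄`. Applied to
`e_♮`, which fixes `(ψ, 0)`, it forces the `xᵢ` into `𝔼⁸`. -/

theorem cliffordι_injective (Q : QuadraticForm ℝ V) :
    Function.Injective (CliffordAlgebra.ι Q) := by
  intro x y h
  have h2 := congrArg (CliffordAlgebra.equivExterior Q) h
  have key : ∀ v, CliffordAlgebra.equivExterior Q (CliffordAlgebra.ι Q v) =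
      ExteriorAlgebra.ι ℝ v := fun v =>
    CliffordAlgebra.changeForm_ι (CliffordAlgebra.changeForm.associated_neg_proof (Q := Q)) v
  rw [key, key] at h2
  exact (ExteriorAlgebra.ι_inj ℝ x y).1 h2

theorem coe_mul_coe_inv (Q : QuadraticForm ℝ V) (g : spinGroup Q) :
    (g : CliffordAlgebra Q) * ((g⁻¹ : spinGroup Q) : CliffordAlgebra Q) = 1 := by
  rw [← Submonoid.coe_mul, mul_inv_cancel, Submonoid.coe_one]

theorem coe_inv_mul_coe (Q : QuadraticForm ℝ V) (g : spinGroup Q) :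
    ((g⁻¹ : spinGroup Q) : CliffordAlgebra Q) * (g : CliffordAlgebra Q) = 1 := by
  rw [← Submonoid.coe_mul, inv_mul_cancel, Submonoid.coe_one]

theorem toCliff_spinAct (Q : QuadraticForm ℝ V) (g : spinGroup Q) (p : ExteriorAlgebra ℝ V) :
    toCliff Q (spinAct Q g p) =
      (g : CliffordAlgebra Q) * toCliff Q p * ((g⁻¹ : spinGroup Q) : CliffordAlgebra Q) := by
  rw [spinAct, LinearEquiv.apply_symm_apply]

theorem spinAct_one (Q : QuadraticForm ℝ V) (p : ExteriorAlgebra ℝ V) : spinAct Q 1 p = p := by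
  apply (toCliff Q).injective
  rw [toCliff_spinAct, inv_one, Submonoid.coe_one, one_mul, mul_one]

theorem spinAct_mul (Q : QuadraticForm ℝ V) (g h : spinGroup Q) (p : ExteriorAlgebra ℝ V) :
    spinAct Q (g * h) p = spinAct Q g (spinAct Q h p) := by
  apply (toCliff Q).injective
  simp only [toCliff_spinAct, mul_inv_rev, Submonoid.coe_mul, mul_assoc]

theorem spinAct_inv_spinAct (Q : QuadraticForm ℝ V) (g : spinGroup Q) (p : ExteriorAlgebra ℝ V) :
    spinAct Q g⁻¹ (spinAct Q g p) = p := by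
  rw [← spinAct_mul, inv_mul_cancel, spinAct_one]

theorem spinAct_neg (Q : QuadraticForm ℝ V) (g : spinGroup Q) (p : ExteriorAlgebra ℝ V) :
    spinAct Q g (-p) = -spinAct Q g p := by
  apply (toCliff Q).injective
  simp only [toCliff_spinAct, map_neg, mul_neg, neg_mul]

/-- Elements of the spin group normalise `V` inside the Clifford algebra; this supplies the vector
action without constructing the covering of `SO`. -/
theorem exists_ι_eq_conj (Q : QuadraticForm ℝ V) (g : spinGroup Q) (v : V) :
    ∃ w, CliffordAlgebra.ι Q w = (g : CliffordAlgebra Q) * CliffordAlgebra.ι Q v *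
      ((g⁻¹ : spinGroup Q) : CliffordAlgebra Q) := by
  have h := spinGroup.conjAct_smul_ι_mem_range_ι (Q := Q) (x := spinGroup.toUnits g) g.2 v
  obtain ⟨w, hw⟩ := h
  refine ⟨w, ?_⟩
  rw [hw, ConjAct.units_smul_def, ConjAct.ofConjAct_toConjAct, ← map_inv]
  rfl

/-- The action of the spin group on vectors. -/
def vecAct (Q : QuadraticForm ℝ V) (g : spinGroup Q) (v : V) : V :=
  (exists_ι_eq_conj Q g v).choose

theorem ι_vecAct (Q : QuadraticForm ℝ V) (g : spinGroup Q) (v : V) :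
    CliffordAlgebra.ι Q (vecAct Q g v) = (g : CliffordAlgebra Q) * CliffordAlgebra.ι Q v *
      ((g⁻¹ : spinGroup Q) : CliffordAlgebra Q) :=
  (exists_ι_eq_conj Q g v).choose_spec

/-- Clearing the inverse turns a conjugation into a commutation relation, the form in which images
of particular vectors are computed. -/
theorem vecAct_eq_iff (Q : QuadraticForm ℝ V) (g : spinGroup Q) (v w : V) :
    vecAct Q g v = w ↔ (g : CliffordAlgebra Q) * CliffordAlgebra.ι Q v =
      CliffordAlgebra.ι Q w * g := by
  rw [← (cliffordι_injective Q).eq_iff, ι_vecAct]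
  constructor
  · intro h
    rw [← h, mul_assoc, coe_inv_mul_coe, mul_one]
  · intro h
    rw [h, mul_assoc, coe_mul_coe_inv, mul_one]

theorem vecAct_vecAct_inv (Q : QuadraticForm ℝ V) (g : spinGroup Q) (v : V) :
    vecAct Q g (vecAct Q g⁻¹ v) = v := by
  rw [vecAct_eq_iff, ι_vecAct, inv_inv, ← mul_assoc, ← mul_assoc, coe_mul_coe_inv, one_mul]

/-- The polar form is the anticommutator in the Clifford algebra, which is a scalar, and conjugation
fixes scalars. -/
theorem polar_vecAct (Q : QuadraticForm ℝ V) (g : spinGroup Q) (v w : V) :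
    QuadraticMap.polar Q (vecAct Q g v) (vecAct Q g w) = QuadraticMap.polar Q v w := by
  apply (algebraMap ℝ (CliffordAlgebra Q)).injective
  have h : ∀ x y : CliffordAlgebra Q, (g : CliffordAlgebra Q) * x *
      ((g⁻¹ : spinGroup Q) : CliffordAlgebra Q) * (g * y *
      ((g⁻¹ : spinGroup Q) : CliffordAlgebra Q)) =
      g * (x * y) * ((g⁻¹ : spinGroup Q) : CliffordAlgebra Q) := by
    intro x y
    calc _ = (g : CliffordAlgebra Q) * x * (((g⁻¹ : spinGroup Q) : CliffordAlgebra Q) * g) * y *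
        ((g⁻¹ : spinGroup Q) : CliffordAlgebra Q) := by simp only [mul_assoc]
      _ = _ := by rw [coe_inv_mul_coe, mul_one, mul_assoc (g : CliffordAlgebra Q)]
  rw [← CliffordAlgebra.ι_mul_ι_add_swap, ← CliffordAlgebra.ι_mul_ι_add_swap, ι_vecAct, ι_vecAct,
    h, h, ← add_mul, ← mul_add, CliffordAlgebra.ι_mul_ι_add_swap, ← Algebra.commutes, mul_assoc,
    coe_mul_coe_inv, mul_one]

theorem conj_prod_ofFn (Q : QuadraticForm ℝ V) (g : spinGroup Q) :
    ∀ {m : ℕ} (x : Fin m → CliffordAlgebra Q),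
      (List.ofFn fun i => (g : CliffordAlgebra Q) * x i *
        ((g⁻¹ : spinGroup Q) : CliffordAlgebra Q)).prod =
      g * (List.ofFn x).prod * ((g⁻¹ : spinGroup Q) : CliffordAlgebra Q)
  | 0, x => by simp [coe_mul_coe_inv]
  | m + 1, x => by
    rw [List.ofFn_succ, List.prod_cons, conj_prod_ofFn Q g fun i => x i.succ, List.ofFn_succ,
      List.prod_cons]
    calc _ = (g : CliffordAlgebra Q) * x 0 * (((g⁻¹ : spinGroup Q) : CliffordAlgebra Q) * g) *
        (List.ofFn fun i => x i.succ).prod * ((g⁻¹ : spinGroup Q) : CliffordAlgebra Q) := by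
          simp only [mul_assoc]
      _ = _ := by rw [coe_inv_mul_coe, mul_one, mul_assoc (g : CliffordAlgebra Q)]

/-- For orthogonal vectors the wedge is a Clifford product and conjugation is multiplicative; the
images are again orthogonal, so their product converts back to a wedge. -/
theorem spinAct_ιMulti (Q : QuadraticForm ℝ V) (g : spinGroup Q) {m : ℕ} (v : Fin m → V)
    (h : ∀ i j, i ≠ j → QuadraticMap.polar Q (v i) (v j) = 0) :
    spinAct Q g (ExteriorAlgebra.ιMulti ℝ m v) =
      ExteriorAlgebra.ιMulti ℝ m fun i => vecAct Q g (v i) := by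
  apply (toCliff Q).injective
  rw [toCliff_spinAct, toCliff_ιMulti Q v h, toCliff_ιMulti]
  · simp only [ι_vecAct]
    rw [conj_prod_ofFn]
  · intro i j hij
    rw [polar_vecAct, h i j hij]

variable {n : Type*} [Fintype n] [DecidableEq n]

theorem mem_susy {Q : QuadraticForm ℝ V} (ρ : CliffordAlgebra Q →ₐ[ℝ] Matrix n n ℝ)
    (p : ExteriorAlgebra ℝ V) (ε : n → ℝ) :
    ε ∈ susy ρ p ↔ (ρ (toCliff Q p)).mulVec ε = ε := Iff.rfl

/-- Preservation of a spinor passes along the orbits of its isotropy group, since `g p g⁻¹ ε = g p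
ε` when `g ε = ε`. -/
theorem mem_susy_spinAct {Q : QuadraticForm ℝ V} (ρ : CliffordAlgebra Q →ₐ[ℝ] Matrix n n ℝ)
    (g : spinGroup Q) (p : ExteriorAlgebra ℝ V) {ε : n → ℝ}
    (hg : (ρ (g : CliffordAlgebra Q)).mulVec ε = ε) :
    ε ∈ susy ρ (spinAct Q g p) ↔ ε ∈ susy ρ p := by
  have hg' : (ρ ((g⁻¹ : spinGroup Q) : CliffordAlgebra Q)).mulVec ε = ε := by
    conv_lhs => rw [← hg]
    rw [Matrix.mulVec_mulVec, ← map_mul, coe_inv_mul_coe, map_one, Matrix.one_mulVec]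
  rw [mem_susy, mem_susy, toCliff_spinAct, map_mul, map_mul, ← Matrix.mulVec_mulVec, hg',
    ← Matrix.mulVec_mulVec]
  constructor
  · intro h
    have h2 := congrArg (ρ ((g⁻¹ : spinGroup Q) : CliffordAlgebra Q)).mulVec h
    rwa [Matrix.mulVec_mulVec, ← map_mul, coe_inv_mul_coe, map_one, Matrix.one_mulVec, hg'] at h2
  · intro h
    rw [h, hg]

end General

/-- An alternating map is multiplied by the determinant under a linear change of its arguments. -/
theorem alternating_linearCombination {V W : Type*} [AddCommGroup V] [Module ℝ V]
    [AddCommGroup W] [Module ℝ W] {m : ℕ} (f : V [⋀^Fin m]→ₗ[ℝ] W) (v : Fin m → V)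
    (A : Matrix (Fin m) (Fin m) ℝ) :
    f (fun i => ∑ j, A i j • v j) = A.det • f v := by
  -- Both sides are alternating in the rows of the matrix, so it suffices to compare them on
  -- permutations of the standard basis, where each produces the sign.
  have key : f.compLinearMap (Fintype.linearCombination ℝ v) =
      (LinearMap.toSpanSingleton ℝ W (f v)).compAlternatingMap Matrix.detRowAlternating := by
    refine Module.Basis.ext_alternating (Pi.basisFun ℝ (Fin m)) fun s hs => ?_
    let σ : Equiv.Perm (Fin m) := Equiv.ofBijective s (Finite.injective_iff_bijective.1 hs)
    have hσ : ∀ i, s i = σ i := fun i => rfl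
    have h1 : f.compLinearMap (Fintype.linearCombination ℝ v)
        (fun i => Pi.basisFun ℝ (Fin m) (s i)) = f (v ∘ σ) := by
      rw [AlternatingMap.compLinearMap_apply]
      congr 1
      funext i
      simp [hσ, Fintype.linearCombination_apply, Pi.single_apply]
    have h2 : Matrix.detRowAlternating (R := ℝ) (fun i => Pi.basisFun ℝ (Fin m) (s i)) =
        ((Equiv.Perm.sign σ : ℤ) : ℝ) := by
      have h3 := (Matrix.detRowAlternating (R := ℝ) (n := Fin m)).map_perm
        (fun i => Pi.basisFun ℝ (Fin m) i) σ
      have h4 : Matrix.detRowAlternating (R := ℝ) (fun i => Pi.basisFun ℝ (Fin m) i) = 1 := by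
        have : (fun i => Pi.basisFun ℝ (Fin m) i) = (1 : Matrix (Fin m) (Fin m) ℝ) := by
          ext i j
          simp [Matrix.one_apply, Pi.single_apply, eq_comm]
        rw [this]
        exact Matrix.det_one
      rw [h4] at h3
      rw [show (fun i => Pi.basisFun ℝ (Fin m) (s i)) =
        (fun i => Pi.basisFun ℝ (Fin m) i) ∘ σ from rfl, h3, Units.smul_def, zsmul_one]
    rw [h1, f.map_perm, LinearMap.compAlternatingMap_apply, h2,
      LinearMap.toSpanSingleton_apply, Units.smul_def, Int.cast_smul_eq_zsmul]
  exact congrArg (fun g => g A) key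

/-! ### The spinor module of `Cl₈` -/

theorem rho8_ι (x : Fin 8 → ℝ) :
    rho8 (CliffordAlgebra.ι quad8 x) = Fintype.linearCombination ℝ gamma8 x := by
  exact CliffordAlgebra.lift_ι_apply _ _ x

theorem octLeft_transpose (i : Fin 7) : (octLeft i).transpose = -octLeft i := by
  have h : ∀ i, (octLeftInt i).transpose = -octLeftInt i := by decide +kernel
  ext a b
  have h2 := congrFun (congrFun (h i) a) b
  simp only [Matrix.transpose_apply, Matrix.neg_apply, octLeft, Matrix.map_apply] at h2 ⊢
  rw [h2, Int.cast_neg]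

theorem gamma8_transpose (i : Fin 8) : (gamma8 i).transpose = -gamma8 i := by
  induction i using Fin.lastCases with
  | last =>
    rw [gamma8_last]
    simp [Matrix.fromBlocks_transpose, Matrix.fromBlocks_neg]
  | cast i =>
    simp [gamma8_castSucc, Matrix.fromBlocks_transpose, Matrix.fromBlocks_neg, octLeft_transpose]

/-- The generators are skew matrices and `star` negates vectors while reversing products.
Consequently `star x * x = 1` makes `x` act orthogonally. -/
theorem rho8_star (x : CliffordAlgebra quad8) : rho8 (star x) = (rho8 x).transpose := by
  induction x using CliffordAlgebra.induction with
  | algebraMap r =>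
    rw [CliffordAlgebra.star_algebraMap, AlgHom.commutes, Matrix.algebraMap_eq_diagonal,
      Matrix.diagonal_transpose]
  | ι x =>
    rw [CliffordAlgebra.star_ι, map_neg, rho8_ι, Fintype.linearCombination_apply,
      Matrix.transpose_sum, ← Finset.sum_neg_distrib]
    simp only [Matrix.transpose_smul, gamma8_transpose, smul_neg]
  | mul a b ha hb => rw [star_mul, map_mul, map_mul, Matrix.transpose_mul, ha, hb]
  | add a b ha hb => rw [star_add, map_add, map_add, Matrix.transpose_add, ha, hb]

theorem quad8_apply (x : Fin 8 → ℝ) : quad8 x = -∑ i, x i * x i := by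
  simp [quad8, QuadraticMap.weightedSumSquares_apply]

theorem polar_quad8 (x y : Fin 8 → ℝ) :
    QuadraticMap.polar quad8 x y = -2 * ∑ i, x i * y i := by
  simp only [QuadraticMap.polar, quad8_apply, Finset.mul_sum, ← Finset.sum_neg_distrib,
    ← Finset.sum_sub_distrib, Pi.add_apply]
  refine Finset.sum_congr rfl fun M _ => ?_
  ring

theorem IsFrame8.polar_eq_zero {w : Fin 4 → Fin 8 → ℝ} (hw : IsFrame8 w) (i j : Fin 4)
    (hij : i ≠ j) : QuadraticMap.polar quad8 (w i) (w j) = 0 := by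
  rw [polar_quad8, hw, if_neg hij, mul_zero]

theorem toCliff_ιMulti_four {V : Type*} [AddCommGroup V] [Module ℝ V] (Q : QuadraticForm ℝ V)
    (w : Fin 4 → V) (h : ∀ i j, i ≠ j → QuadraticMap.polar Q (w i) (w j) = 0) :
    toCliff Q (ExteriorAlgebra.ιMulti ℝ 4 w) =
      CliffordAlgebra.ι Q (w 0) * (CliffordAlgebra.ι Q (w 1) * (CliffordAlgebra.ι Q (w 2) *
        CliffordAlgebra.ι Q (w 3))) := by
  rw [toCliff_ιMulti Q w h]
  simp only [List.ofFn_succ, List.ofFn_zero, List.prod_cons, List.prod_nil, mul_one]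
  rfl

theorem ι_mul_ι_swap {V : Type*} [AddCommGroup V] [Module ℝ V] (Q : QuadraticForm ℝ V) {a b : V}
    (h : QuadraticMap.polar Q a b = 0) : CliffordAlgebra.ι Q b * CliffordAlgebra.ι Q a =
      -(CliffordAlgebra.ι Q a * CliffordAlgebra.ι Q b) := by
  have h2 := CliffordAlgebra.ι_mul_ι_add_swap (Q := Q) a b
  rw [h, map_zero] at h2
  exact eq_neg_of_add_eq_zero_right h2

theorem quad8_frame {w : Fin 4 → Fin 8 → ℝ} (hw : IsFrame8 w) (i : Fin 4) :
    quad8 (w i) = -1 := by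
  rw [quad8_apply, hw, if_pos rfl]

/-- `star` reverses the product with four cancelling signs; the product then collapses from the
middle, each unit vector squaring to `-1`. -/
theorem star_mul_self_frame {w : Fin 4 → Fin 8 → ℝ} (hw : IsFrame8 w) :
    star (toCliff quad8 (ExteriorAlgebra.ιMulti ℝ 4 w)) *
      toCliff quad8 (ExteriorAlgebra.ιMulti ℝ 4 w) = 1 := by
  have hs : ∀ i z, CliffordAlgebra.ι quad8 (w i) * (CliffordAlgebra.ι quad8 (w i) * z) = -z := by
    intro i z
    rw [← mul_assoc, CliffordAlgebra.ι_sq_scalar, quad8_frame hw, map_neg, map_one, neg_mul,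
      one_mul]
  have hs1 : ∀ i, CliffordAlgebra.ι quad8 (w i) * CliffordAlgebra.ι quad8 (w i) = -1 := by
    intro i
    rw [CliffordAlgebra.ι_sq_scalar, quad8_frame hw, map_neg, map_one]
  rw [toCliff_ιMulti_four _ _ hw.polar_eq_zero]
  simp only [star_mul, CliffordAlgebra.star_ι, mul_neg, neg_mul, neg_neg, mul_assoc, hs, hs1]

/-! ### The form obtained by squaring a spinor, and its calibrated planes -/

theorem cayleyForm_apply (φ : Idx16 → ℝ) (w : Fin 4 → Fin 8 → ℝ) :
    cayleyForm φ w = (φ ⬝ᵥ φ)⁻¹ *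
      (φ ⬝ᵥ (rho8 (toCliff quad8 (ExteriorAlgebra.ιMulti ℝ 4 w))).mulVec φ) := rfl

theorem dotProduct_self_pos {n : Type*} [Fintype n] {φ : n → ℝ} (h : φ ≠ 0) : 0 < φ ⬝ᵥ φ :=
  lt_of_le_of_ne (Finset.sum_nonneg fun _ _ => mul_self_nonneg _)
    fun e => h (dotProduct_self_eq_zero.1 e.symm)

/-- The plane acts orthogonally, so both quadratic terms equal `φ ⬝ᵥ φ`. Nonnegativity of the left
side gives the comass bound, and its vanishing the equality case. -/
theorem dotProduct_sub_frame {w : Fin 4 → Fin 8 → ℝ} (hw : IsFrame8 w) (φ : Idx16 → ℝ) :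
    (φ - (rho8 (toCliff quad8 (ExteriorAlgebra.ιMulti ℝ 4 w))).mulVec φ) ⬝ᵥ
      (φ - (rho8 (toCliff quad8 (ExteriorAlgebra.ιMulti ℝ 4 w))).mulVec φ) =
    2 * (φ ⬝ᵥ φ) -
      2 * (φ ⬝ᵥ (rho8 (toCliff quad8 (ExteriorAlgebra.ιMulti ℝ 4 w))).mulVec φ) := by
  have h1 : (rho8 (toCliff quad8 (ExteriorAlgebra.ιMulti ℝ 4 w))).transpose *
      rho8 (toCliff quad8 (ExteriorAlgebra.ιMulti ℝ 4 w)) = 1 := by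
    rw [← rho8_star, ← map_mul, star_mul_self_frame hw, map_one]
  set X := rho8 (toCliff quad8 (ExteriorAlgebra.ιMulti ℝ 4 w)) with hX
  have h2 : X.mulVec φ ⬝ᵥ X.mulVec φ = φ ⬝ᵥ φ := by
    rw [Matrix.dotProduct_mulVec, ← Matrix.mulVec_transpose, Matrix.mulVec_mulVec, h1,
      Matrix.one_mulVec]
  rw [sub_dotProduct, dotProduct_sub, dotProduct_sub, h2, dotProduct_comm (X.mulVec φ) φ]
  ring

theorem cayleyForm_le_one {φ : Idx16 → ℝ} (hφ : φ ≠ 0) {w : Fin 4 → Fin 8 → ℝ}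
    (hw : IsFrame8 w) : cayleyForm φ w ≤ 1 := by
  have hp := dotProduct_self_pos hφ
  have h := dotProduct_sub_frame hw φ
  have h0 : 0 ≤ (φ - (rho8 (toCliff quad8 (ExteriorAlgebra.ιMulti ℝ 4 w))).mulVec φ) ⬝ᵥ
      (φ - (rho8 (toCliff quad8 (ExteriorAlgebra.ιMulti ℝ 4 w))).mulVec φ) :=
    Finset.sum_nonneg fun _ _ => mul_self_nonneg _
  rw [cayleyForm_apply, inv_mul_le_iff₀ hp]
  linarith

theorem cayleyForm_eq_one_iff {φ : Idx16 → ℝ} (hφ : φ ≠ 0) {w : Fin 4 → Fin 8 → ℝ}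
    (hw : IsFrame8 w) :
    cayleyForm φ w = 1 ↔ φ ∈ susy rho8 (ExteriorAlgebra.ιMulti ℝ 4 w) := by
  have hp := dotProduct_self_pos hφ
  have h := dotProduct_sub_frame hw φ
  rw [cayleyForm_apply, inv_mul_eq_one₀ hp.ne', mem_susy]
  constructor
  · intro e
    rw [← e, sub_self, dotProduct_self_eq_zero, sub_eq_zero] at h
    exact h.symm
  · intro e
    rw [e]

/-- The frame in `IsCalibrated` is a choice, but `ζ · φ = φ` sees only the multivector, so any frame
representing `ζ` serves. -/
theorem mem_susy_iff_isCalibrated {ζ : ExteriorAlgebra ℝ (Fin 8 → ℝ)} (hζ : IsPlane8 ζ)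
    {φ : Idx16 → ℝ} (hφ : φ ≠ 0) :
    φ ∈ susy rho8 ζ ↔ IsCalibrated (cayleyForm φ) ζ := by
  constructor
  · intro h
    obtain ⟨w, hw, rfl⟩ := hζ
    exact ⟨fun x hx => cayleyForm_le_one hφ hx, w, hw, rfl, (cayleyForm_eq_one_iff hφ hw).2 h⟩
  · rintro ⟨-, w, hw, rfl, h⟩
    exact (cayleyForm_eq_one_iff hφ hw).1 h

/-! ### Chirality, and planes under the spin group in eight dimensions -/

/-- The chirality operator anticommutes with every generator, so conjugation by it implements the
grading involution; in particular it commutes with spin elements and 4-planes. -/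
theorem chir8_mul_rho8 (x : CliffordAlgebra quad8) :
    chir8 * rho8 x = rho8 (CliffordAlgebra.involute x) * chir8 := by
  induction x using CliffordAlgebra.induction with
  | algebraMap r => rw [AlgHom.commutes, AlgHom.commutes, AlgHom.commutes, ← Algebra.commutes]
  | ι x =>
    rw [CliffordAlgebra.involute_ι, map_neg, rho8_ι, Fintype.linearCombination_apply,
      Finset.mul_sum, neg_mul, Finset.sum_mul, ← Finset.sum_neg_distrib]
    simp only [mul_smul_comm, smul_mul_assoc, chir8_anti, smul_neg]
  | mul a b ha hb => rw [map_mul, map_mul, map_mul, ← mul_assoc, ha, mul_assoc, hb, mul_assoc]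
  | add a b ha hb => rw [map_add, map_add, map_add, mul_add, add_mul, ha, hb]

theorem involute_toCliff_plane8 {ζ : ExteriorAlgebra ℝ (Fin 8 → ℝ)} (hζ : IsPlane8 ζ) :
    CliffordAlgebra.involute (toCliff quad8 ζ) = toCliff quad8 ζ := by
  obtain ⟨w, hw, rfl⟩ := hζ
  rw [toCliff_ιMulti_four _ _ hw.polar_eq_zero]
  simp only [map_mul, CliffordAlgebra.involute_ι, mul_neg, neg_mul, neg_neg]

theorem chir8_mulVec_mem {K : Subgroup (spinGroup quad8)} {ζ : ExteriorAlgebra ℝ (Fin 8 → ℝ)}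
    (hζ : IsPlane8 ζ) {φ : Idx16 → ℝ} (hφ : φ ∈ invariants rho8 K ⊓ susy rho8 ζ) :
    chir8.mulVec φ ∈ invariants rho8 K ⊓ susy rho8 ζ := by
  have h : ∀ x, CliffordAlgebra.involute x = x → (rho8 x).mulVec φ = φ →
      (rho8 x).mulVec (chir8.mulVec φ) = chir8.mulVec φ := by
    intro x hx hx2
    conv_lhs => rw [Matrix.mulVec_mulVec, ← hx, ← chir8_mul_rho8, ← Matrix.mulVec_mulVec, hx2]
  exact ⟨fun g hg => h _ (spinGroup.involute_eq g.2) (hφ.1 g hg),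
    h _ (involute_toCliff_plane8 hζ) hφ.2⟩

/-- The space is stable under `chir8`, which squares to one: `φ + chir8 φ` has positive chirality
unless it vanishes, and then `φ` itself has negative chirality. -/
theorem exists_chiral {K : Subgroup (spinGroup quad8)} {ζ : ExteriorAlgebra ℝ (Fin 8 → ℝ)}
    (hζ : IsPlane8 ζ) (h : invariants rho8 K ⊓ susy rho8 ζ ≠ ⊥) :
    ∃ φ ∈ invariants rho8 K ⊓ susy rho8 ζ, φ ≠ 0 ∧
      (chir8.mulVec φ = φ ∨ chir8.mulVec φ = -φ) := by
  obtain ⟨φ, hφ, h0⟩ := Submodule.exists_mem_ne_zero_of_ne_bot h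
  have hc := chir8_mulVec_mem hζ hφ
  have hcc : chir8.mulVec (chir8.mulVec φ) = φ := by
    rw [Matrix.mulVec_mulVec, chir8_sq, Matrix.one_mulVec]
  by_cases h1 : φ + chir8.mulVec φ = 0
  · exact ⟨φ, hφ, h0, Or.inr (eq_neg_of_add_eq_zero_right h1)⟩
  · refine ⟨_, add_mem hφ hc, h1, Or.inl ?_⟩
    rw [Matrix.mulVec_add, hcc, add_comm]

theorem isPlane8_spinAct (g : spinGroup quad8) {ζ : ExteriorAlgebra ℝ (Fin 8 → ℝ)}
    (hζ : IsPlane8 ζ) : IsPlane8 (spinAct quad8 g ζ) := by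
  obtain ⟨w, hw, rfl⟩ := hζ
  refine ⟨_, ?_, spinAct_ιMulti quad8 g w hw.polar_eq_zero⟩
  intro a b
  have h := polar_vecAct quad8 g (w a) (w b)
  rw [polar_quad8, polar_quad8, hw] at h
  linarith

/-! ### The spinor module of `Cl₁,₁₀` -/

theorem rho11_ι (x : Mink) :
    rho11 (CliffordAlgebra.ι quad11 x) = Fintype.linearCombination ℝ gamma11 x := by
  exact CliffordAlgebra.lift_ι_apply _ _ x

theorem rho11_stdVec (M : Fin 11) :
    rho11 (CliffordAlgebra.ι quad11 (stdVec M)) = gamma11 M := by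
  rw [rho11_ι, stdVec, Fintype.linearCombination_apply_single, one_smul]

/-- The blocks are twice the chiral projectors, so the kernel consists of pairs (negative,
positive). -/
theorem rho11_ePlus :
    rho11 (CliffordAlgebra.ι quad11 ePlus) = Matrix.fromBlocks 0 (1 - chir8) (1 + chir8) 0 := by
  rw [ePlus, map_add, map_add, rho11_stdVec, rho11_stdVec, gamma11_zero,
    show (9 : Fin 11) = (Fin.last 8).castSucc.succ from rfl, gamma11_nine,
    Matrix.fromBlocks_add, add_zero, add_comm (-chir8), ← sub_eq_add_neg, add_comm chir8]

/-- The factor `e_♮` cancels the minus sign in the upper block of `Γᵢ`; this is why `Cl₈` is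
embedded through `x e_♮`. -/
theorem rho11_incl8_nat (x : Fin 8 → ℝ) :
    rho11 (CliffordAlgebra.ι quad11 (incl8 x) * CliffordAlgebra.ι quad11 (stdVec 10)) =
      Matrix.fromBlocks 0 (rho8 (CliffordAlgebra.ι quad8 x))
        (rho8 (CliffordAlgebra.ι quad8 x)) 0 := by
  have h : rho11 (CliffordAlgebra.ι quad11 (incl8 x)) =
      Matrix.fromBlocks 0 (-rho8 (CliffordAlgebra.ι quad8 x))
        (rho8 (CliffordAlgebra.ι quad8 x)) 0 := by
    rw [incl8, Fintype.linearCombination_apply, map_sum, map_sum, rho8_ι,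
      Fintype.linearCombination_apply]
    simp only [map_smul, rho11_stdVec, gamma11_mid]
    have : ∀ s : Finset (Fin 8), ∑ i ∈ s, x i • Matrix.fromBlocks 0 (-gamma8 i) (gamma8 i) 0 =
        Matrix.fromBlocks 0 (-∑ i ∈ s, x i • gamma8 i) (∑ i ∈ s, x i • gamma8 i) 0 := by
      intro s
      induction s using Finset.induction_on with
      | empty => simp
      | insert a s ha ih =>
        rw [Finset.sum_insert ha, ih, Finset.sum_insert ha, Matrix.fromBlocks_smul,
          Matrix.fromBlocks_add, smul_zero, add_zero, smul_neg, neg_add]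
    exact this _
  rw [map_mul, h, rho11_stdVec, show (10 : Fin 11) = (Fin.last 9).succ from rfl, gamma11_nat,
    Matrix.fromBlocks_multiply]
  simp

theorem spinorIncl_apply (φ : Idx16 → ℝ) :
    spinorIncl φ = Sum.elim ((1 / 2 : ℝ) • (φ - chir8.mulVec φ))
      ((1 / 2 : ℝ) • (φ + chir8.mulVec φ)) := by
  rw [spinorIncl, Matrix.mulVecLin_apply, Matrix.fromRows_mulVec, Matrix.smul_mulVec,
    Matrix.smul_mulVec, Matrix.sub_mulVec, Matrix.add_mulVec, Matrix.one_mulVec]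

theorem chir8_mulVec_mulVec (φ : Idx16 → ℝ) : chir8.mulVec (chir8.mulVec φ) = φ := by
  rw [Matrix.mulVec_mulVec, chir8_sq, Matrix.one_mulVec]

theorem spinorIncl_injective : Function.Injective spinorIncl := by
  intro φ χ h
  rw [spinorIncl_apply, spinorIncl_apply] at h
  have h1 := congrArg (fun f => f ∘ Sum.inl) h
  have h2 := congrArg (fun f => f ∘ Sum.inr) h
  simp only [Sum.elim_comp_inl, Sum.elim_comp_inr] at h1 h2
  have h3 := congrArg₂ (· + ·) h1 h2
  simp only [← smul_add, sub_add_add_cancel] at h3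
  rwa [← two_smul ℝ φ, ← two_smul ℝ χ, smul_smul, smul_smul, one_div,
    inv_mul_cancel₀ two_ne_zero, one_smul, one_smul] at h3

theorem mem_deltaPrime (ε : Idx32 → ℝ) :
    ε ∈ deltaPrime ↔ (rho11 (CliffordAlgebra.ι quad11 ePlus)).mulVec ε = 0 := Iff.rfl

theorem range_spinorIncl : LinearMap.range spinorIncl = deltaPrime := by
  ext ε
  rw [mem_deltaPrime, rho11_ePlus]
  constructor
  · rintro ⟨φ, rfl⟩
    rw [spinorIncl_apply, Matrix.fromBlocks_mulVec]
    simp only [Sum.elim_comp_inl, Sum.elim_comp_inr, Matrix.zero_mulVec, add_zero,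
      Matrix.mulVec_smul, Matrix.sub_mulVec, Matrix.add_mulVec, Matrix.one_mulVec,
      Matrix.mulVec_add, Matrix.mulVec_sub, chir8_mulVec_mulVec]
    funext i
    rcases i with i | i <;>
    simp only [Sum.elim_inl, Sum.elim_inr, Pi.add_apply, Pi.sub_apply, Pi.smul_apply,
      Pi.zero_apply, smul_eq_mul] <;>
    ring
  · intro h
    rw [Matrix.fromBlocks_mulVec] at h
    have h1 := congrArg (fun f => f ∘ Sum.inl) h
    have h2 := congrArg (fun f => f ∘ Sum.inr) h
    simp only [Sum.elim_comp_inl, Sum.elim_comp_inr, Matrix.zero_mulVec, zero_add, add_zero,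
      Matrix.sub_mulVec, Matrix.add_mulVec, Matrix.one_mulVec] at h1 h2
    have h1' : chir8.mulVec (ε ∘ Sum.inr) = ε ∘ Sum.inr := (sub_eq_zero.1 h1).symm
    have h2' : chir8.mulVec (ε ∘ Sum.inl) = -(ε ∘ Sum.inl) := eq_neg_of_add_eq_zero_right h2
    -- The two blocks of a spinor in the kernel have opposite chirality, so they are the chiral
    -- components of their sum.
    refine ⟨ε ∘ Sum.inl + ε ∘ Sum.inr, ?_⟩
    rw [spinorIncl_apply, Matrix.mulVec_add, h1', h2']
    conv_rhs => rw [← Sum.elim_comp_inl_inr ε]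
    congr 1
    · funext i
      simp only [Pi.smul_apply, Pi.sub_apply, Pi.add_apply, Pi.neg_apply, smul_eq_mul]
      ring
    · funext i
      simp only [Pi.smul_apply, Pi.add_apply, Pi.neg_apply, smul_eq_mul]
      ring

theorem finrank_deltaPrime : Module.finrank ℝ deltaPrime = 16 := by
  rw [← range_spinorIncl, LinearMap.finrank_range_of_inj spinorIncl_injective]
  simp

/-- A vector reverses chirality, and `x e_♮` exchanges the two blocks, so the pattern (negative,
positive) is kept. -/
theorem spinorIncl_mulVec (x : CliffordAlgebra quad8) (φ : Idx16 → ℝ) :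
    spinorIncl ((rho8 x).mulVec φ) = (rho11 (cliffEmb x)).mulVec (spinorIncl φ) := by
  induction x using CliffordAlgebra.induction generalizing φ with
  | algebraMap r =>
    rw [AlgHom.commutes, AlgHom.commutes, AlgHom.commutes]
    simp only [Algebra.algebraMap_eq_smul_one, Matrix.smul_mulVec, Matrix.one_mulVec, map_smul]
  | ι x =>
    have h := chir8_mul_rho8 (CliffordAlgebra.ι quad8 x)
    rw [CliffordAlgebra.involute_ι, map_neg, neg_mul] at h
    rw [cliffEmb_ι, rho11_incl8_nat, spinorIncl_apply, spinorIncl_apply, Matrix.fromBlocks_mulVec]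
    simp only [Sum.elim_comp_inl, Sum.elim_comp_inr, Matrix.zero_mulVec, add_zero,
      Matrix.mulVec_smul, Matrix.mulVec_add, Matrix.mulVec_sub]
    rw [Matrix.mulVec_mulVec, h, Matrix.neg_mulVec, ← Matrix.mulVec_mulVec, sub_neg_eq_add,
      ← sub_eq_add_neg, sub_self, smul_zero, zero_add, add_zero]
  | mul a b ha hb =>
    rw [map_mul, map_mul, map_mul, ← Matrix.mulVec_mulVec, ← Matrix.mulVec_mulVec, ha, hb]
  | add a b ha hb =>
    rw [map_add, map_add, map_add, Matrix.add_mulVec, Matrix.add_mulVec, map_add, ha, hb]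

theorem ePlus_mulVec_spinorIncl (φ : Idx16 → ℝ) :
    (rho11 (CliffordAlgebra.ι quad11 ePlus)).mulVec (spinorIncl φ) = 0 := by
  rw [← mem_deltaPrime, ← range_spinorIncl]
  exact ⟨φ, rfl⟩

theorem rho11_nullRot_mulVec (c : Mink) (ε : Idx32 → ℝ) :
    (rho11 (nullRot c)).mulVec ε = ε + (1 / 2 : ℝ) • (rho11 (CliffordAlgebra.ι quad11 c)).mulVec
      ((rho11 (CliffordAlgebra.ι quad11 ePlus)).mulVec ε) := by
  rw [nullRot, map_add, map_one, map_smul, map_mul, Matrix.add_mulVec, Matrix.one_mulVec,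
    Matrix.smul_mulVec, Matrix.mulVec_mulVec]

theorem rho11_ι_mulVec_mulVec (c : Mink) (ε : Idx32 → ℝ) :
    (rho11 (CliffordAlgebra.ι quad11 c)).mulVec
      ((rho11 (CliffordAlgebra.ι quad11 c)).mulVec ε) = quad11 c • ε := by
  rw [Matrix.mulVec_mulVec, ← map_mul, CliffordAlgebra.ι_sq_scalar, AlgHom.commutes,
    Algebra.algebraMap_eq_smul_one, Matrix.smul_mulVec, Matrix.one_mulVec]

theorem nullRotations_mulVec {r : spinGroup quad11} (hr : r ∈ nullRotations) {ε : Idx32 → ℝ}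
    (hε : ε ∈ deltaPrime) : (rho11 (r : CliffordAlgebra quad11)).mulVec ε = ε := by
  obtain ⟨c, -, hr⟩ := hr
  rw [hr, rho11_nullRot_mulVec, (mem_deltaPrime ε).1 hε, Matrix.mulVec_zero, smul_zero, add_zero]

theorem InE9.quad11_eq {c : Mink} (hc : InE9 c) : quad11 c = ∑ M, c M * c M := by
  rw [quad11_apply]
  refine Finset.sum_congr rfl fun M _ => ?_
  induction M using Fin.cases with
  | zero => rw [hc.1, zero_mul, mul_zero]
  | succ M => rw [minkSign, Fin.cons_succ, one_mul]

theorem InE9.eq_zero_of_quad11 {c : Mink} (hc : InE9 c) (h : quad11 c = 0) : c = 0 := by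
  rw [hc.quad11_eq] at h
  exact dotProduct_self_eq_zero.1 h

/-- A single nontrivial element suffices: invariance says `c e₊ ε = 0`, and another factor `c` gives
`|c|² e₊ ε = 0` with `|c|² ≠ 0`, since `𝔼⁹` is positive definite. -/
theorem invariants_eq_deltaPrime {N : Subgroup (spinGroup quad11)} (hN : N ≤ nullRotations)
    (hN1 : N ≠ ⊥) : invariants rho11 N = deltaPrime := by
  refine le_antisymm (fun ε hε => ?_) fun ε hε g hg => nullRotations_mulVec (hN hg) hε
  obtain ⟨g, hg, hg1⟩ := (Subgroup.bot_or_exists_ne_one N).resolve_left hN1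
  obtain ⟨c, hc, hgc⟩ := hN hg
  have h := hε g hg
  rw [hgc, rho11_nullRot_mulVec, add_eq_left] at h
  have h2 := (smul_eq_zero.1 h).resolve_left (by norm_num)
  have h3 := congrArg (rho11 (CliffordAlgebra.ι quad11 c)).mulVec h2
  rw [rho11_ι_mulVec_mulVec, Matrix.mulVec_zero] at h3
  refine (smul_eq_zero.1 h3).resolve_left fun hq => hg1 (Subtype.ext ?_)
  rw [hgc, hc.eq_zero_of_quad11 hq, nullRot_zero, Submonoid.coe_one]

/-! ### Branes -/

theorem minkInner_eq (x y : Mink) : minkInner x y =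
    -(x 0 * y 0) + (∑ k : Fin 8, x k.castSucc.castSucc.succ * y k.castSucc.castSucc.succ) +
      x 9 * y 9 + x 10 * y 10 := by
  rw [minkInner, sum_eleven]
  have h9 : minkSign 9 = 1 := rfl
  have h10 : minkSign 10 = 1 := rfl
  have h0 : minkSign 0 = -1 := rfl
  have hk : ∀ k : Fin 8, minkSign k.castSucc.castSucc.succ = 1 := fun k => by
    rw [minkSign, Fin.cons_succ]
  simp only [h9, h10, h0, hk, one_mul, neg_mul]

theorem minkInner_incl8 (x y : Fin 8 → ℝ) : minkInner (incl8 x) (incl8 y) = ∑ i, x i * y i := by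
  rw [minkInner_eq]
  simp only [incl8_mid, incl8_zero, incl8_nine, incl8_nat]
  ring

theorem minkInner_comm (x y : Mink) : minkInner x y = minkInner y x :=
  Finset.sum_congr rfl fun M _ => by rw [mul_comm (x M)]

theorem minkInner_stdVec (M : Fin 11) (x : Mink) :
    minkInner (stdVec M) x = minkSign M * x M := by
  rw [minkInner, Finset.sum_eq_single M]
  · rw [stdVec, Pi.single_eq_same, one_mul]
  · intro b _ hb
    rw [stdVec, Pi.single_eq_of_ne hb, zero_mul, mul_zero]
  · exact fun h => absurd (Finset.mem_univ _) h

/-- The basis `e₀, e₉, x₁, …, x₄` of a brane. -/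
def braneFrame (x : Fin 4 → Mink) : Fin 6 → Mink := Fin.cons (stdVec 0) (Fin.cons (stdVec 9) x)

theorem ιMulti_braneFrame (x : Fin 4 → Mink) :
    ExteriorAlgebra.ιMulti ℝ 6 (braneFrame x) = ExteriorAlgebra.ι ℝ (stdVec 0) *
      ExteriorAlgebra.ι ℝ (stdVec 9) * ExteriorAlgebra.ιMulti ℝ 4 x := by
  rw [ExteriorAlgebra.ιMulti_succ_apply, ExteriorAlgebra.ιMulti_succ_apply, mul_assoc]
  rfl

theorem brane_ιMulti (w : Fin 4 → Fin 8 → ℝ) :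
    brane (ExteriorAlgebra.ιMulti ℝ 4 w) =
      ExteriorAlgebra.ιMulti ℝ 6 (braneFrame fun i => incl8 (w i)) := by
  rw [brane_eq, ιMulti_braneFrame, ExteriorAlgebra.map_apply_ιMulti]
  rfl

/-- An orthonormal basis of a `(5,1)`-plane, with the timelike vector first. -/
def IsFrame51 (v : Fin 6 → Mink) : Prop :=
  ∀ a b, minkInner (v a) (v b) = if a = b then (if a = 0 then -1 else 1) else 0

theorem IsFrame51.polar_eq_zero {v : Fin 6 → Mink} (hv : IsFrame51 v) (i j : Fin 6)
    (hij : i ≠ j) : QuadraticMap.polar quad11 (v i) (v j) = 0 := by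
  rw [polar_quad11, hv, if_neg hij, mul_zero]

theorem isFrame51_cons {x₀ x₁ : Mink} {x : Fin 4 → Mink} (h00 : minkInner x₀ x₀ = -1)
    (h11 : minkInner x₁ x₁ = 1) (h01 : minkInner x₀ x₁ = 0) (h0 : ∀ a, minkInner x₀ (x a) = 0)
    (h1 : ∀ a, minkInner x₁ (x a) = 0)
    (hx : ∀ a b, minkInner (x a) (x b) = if a = b then 1 else 0) :
    IsFrame51 (Fin.cons x₀ (Fin.cons x₁ x)) := by
  intro a b
  induction a using Fin.cases with
  | zero =>
    induction b using Fin.cases with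
    | zero => rw [if_pos rfl, if_pos rfl, Fin.cons_zero, h00]
    | succ b =>
      rw [if_neg (Fin.succ_ne_zero b).symm, Fin.cons_zero, Fin.cons_succ]
      induction b using Fin.cases with
      | zero => exact h01
      | succ b => exact h0 b
  | succ a =>
    rw [if_neg (Fin.succ_ne_zero a), Fin.cons_succ]
    induction b using Fin.cases with
    | zero =>
      rw [if_neg (Fin.succ_ne_zero a), Fin.cons_zero, minkInner_comm]
      induction a using Fin.cases with
      | zero => exact h01
      | succ a => exact h0 a
    | succ b =>
      simp only [Fin.cons_succ, Fin.succ_inj]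
      induction a using Fin.cases with
      | zero =>
        rw [Fin.cons_zero]
        induction b using Fin.cases with
        | zero => rw [if_pos rfl, Fin.cons_zero, h11]
        | succ b => rw [if_neg (Fin.succ_ne_zero b).symm, Fin.cons_succ, h1]
      | succ a =>
        rw [Fin.cons_succ]
        induction b using Fin.cases with
        | zero => rw [if_neg (Fin.succ_ne_zero a), Fin.cons_zero, minkInner_comm, h1]
        | succ b => rw [Fin.cons_succ, hx]; simp only [Fin.succ_inj]

theorem isFrame51_braneFrame {x : Fin 4 → Mink}
    (hx : ∀ a b, minkInner (x a) (x b) = if a = b then 1 else 0) (h9 : ∀ a, InE9 (x a)) :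
    IsFrame51 (braneFrame x) := by
  refine isFrame51_cons ?_ ?_ ?_ (fun a => ?_) (fun a => ?_) hx <;> rw [minkInner_stdVec]
  · simp [stdVec, minkSign]
  · simp [stdVec, show minkSign 9 = 1 from rfl]
  · simp [stdVec]
  · rw [(h9 a).1, mul_zero]
  · rw [(h9 a).2, mul_zero]

theorem inE9_incl8 (x : Fin 8 → ℝ) : InE9 (incl8 x) := ⟨incl8_zero x, incl8_nine x⟩

theorem IsFrame8.isFrame51 {w : Fin 4 → Fin 8 → ℝ} (hw : IsFrame8 w) :
    IsFrame51 (braneFrame fun i => incl8 (w i)) :=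
  isFrame51_braneFrame (fun a b => by rw [minkInner_incl8, hw]) fun a => inE9_incl8 _

theorem isPlane51_brane {ζ : ExteriorAlgebra ℝ (Fin 8 → ℝ)} (hζ : IsPlane8 ζ) :
    IsPlane51 (brane ζ) := by
  obtain ⟨w, hw, rfl⟩ := hζ
  exact ⟨_, hw.isFrame51, brane_ιMulti w⟩

theorem toCliff_braneFrame {x : Fin 4 → Mink} (hx : IsFrame51 (braneFrame x)) :
    toCliff quad11 (ExteriorAlgebra.ιMulti ℝ 6 (braneFrame x)) =
      CliffordAlgebra.ι quad11 (stdVec 0) * (CliffordAlgebra.ι quad11 (stdVec 9) *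
        toCliff quad11 (ExteriorAlgebra.ιMulti ℝ 4 x)) := by
  rw [toCliff_ιMulti _ _ hx.polar_eq_zero, toCliff_ιMulti, List.ofFn_succ, List.ofFn_succ,
    List.prod_cons, List.prod_cons]
  · rfl
  · intro i j hij
    exact hx.polar_eq_zero i.succ.succ j.succ.succ
      fun e => hij (Fin.succ_injective _ (Fin.succ_injective _ e))

/-- A pair `(x e_♮)(y e_♮)` equals `-x y`, and four factors make two pairs, so `e_♮` drops out
without a sign. -/
theorem toCliff_incl8_frame {w : Fin 4 → Fin 8 → ℝ} (hw : IsFrame8 w) :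
    toCliff quad11 (ExteriorAlgebra.ιMulti ℝ 4 fun i => incl8 (w i)) =
      cliffEmb (toCliff quad8 (ExteriorAlgebra.ιMulti ℝ 4 w)) := by
  have hn : ∀ x z, CliffordAlgebra.ι quad11 (stdVec 10) * (CliffordAlgebra.ι quad11 (incl8 x) * z) =
      -(CliffordAlgebra.ι quad11 (incl8 x) * (CliffordAlgebra.ι quad11 (stdVec 10) * z)) := by
    intro x z
    rw [← mul_assoc, incl8_nat_anti, neg_mul, mul_assoc]
  have hnn : ∀ z, CliffordAlgebra.ι quad11 (stdVec 10) *
      (CliffordAlgebra.ι quad11 (stdVec 10) * z) = z := by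
    intro z
    rw [← mul_assoc, nat_sq, one_mul]
  rw [toCliff_ιMulti_four _ _ hw.polar_eq_zero, toCliff_ιMulti_four]
  · simp only [map_mul, cliffEmb_ι, mul_assoc, hn, hnn, nat_sq, mul_neg, neg_neg, mul_one]
  · intro i j hij
    rw [polar_quad11, minkInner_incl8, hw, if_neg hij, mul_zero]

theorem toCliff_brane {ζ : ExteriorAlgebra ℝ (Fin 8 → ℝ)} (hζ : IsPlane8 ζ) :
    toCliff quad11 (brane ζ) = CliffordAlgebra.ι quad11 (stdVec 0) *
      (CliffordAlgebra.ι quad11 (stdVec 9) * cliffEmb (toCliff quad8 ζ)) := by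
  obtain ⟨w, hw, rfl⟩ := hζ
  rw [brane_ιMulti, toCliff_braneFrame hw.isFrame51, toCliff_incl8_frame hw]

/-- On the kernel of `Γ₊` one has `e₉ ε = -e₀ ε`, and `e₀² = -1`. Thus the Lorentzian factor of a
brane is invisible there. -/
theorem zero_nine_mulVec {ε : Idx32 → ℝ} (hε : ε ∈ deltaPrime) :
    (rho11 (CliffordAlgebra.ι quad11 (stdVec 0))).mulVec
      ((rho11 (CliffordAlgebra.ι quad11 (stdVec 9))).mulVec ε) = ε := by
  rw [mem_deltaPrime, ePlus, map_add, map_add, Matrix.add_mulVec] at hε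
  rw [eq_neg_of_add_eq_zero_right hε, Matrix.mulVec_neg, rho11_ι_mulVec_mulVec, quad11_apply,
    minkInner_stdVec]
  simp [stdVec, minkSign]

theorem rho11_brane_mulVec {ζ : ExteriorAlgebra ℝ (Fin 8 → ℝ)} (hζ : IsPlane8 ζ)
    (φ : Idx16 → ℝ) : (rho11 (toCliff quad11 (brane ζ))).mulVec (spinorIncl φ) =
      spinorIncl ((rho8 (toCliff quad8 ζ)).mulVec φ) := by
  rw [toCliff_brane hζ, map_mul, map_mul, ← Matrix.mulVec_mulVec, ← Matrix.mulVec_mulVec,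
    ← spinorIncl_mulVec]
  exact zero_nine_mulVec (ePlus_mulVec_spinorIncl _)

theorem mem_susy_brane_iff {ζ : ExteriorAlgebra ℝ (Fin 8 → ℝ)} (hζ : IsPlane8 ζ)
    (φ : Idx16 → ℝ) : spinorIncl φ ∈ susy rho11 (brane ζ) ↔ φ ∈ susy rho8 ζ := by
  rw [mem_susy, rho11_brane_mulVec hζ, spinorIncl_injective.eq_iff, mem_susy]

/-! ### `Cl₈` embeds in `Cl₁,₁₀` -/

/-- The component of a vector of Minkowski space in `𝔼⁸`. -/
def proj8 : Mink →ₗ[ℝ] (Fin 8 → ℝ) :=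
  LinearMap.funLeft ℝ ℝ fun k : Fin 8 => k.castSucc.castSucc.succ

theorem proj8_apply (v : Mink) (k : Fin 8) : proj8 v k = v k.castSucc.castSucc.succ := rfl

theorem proj8_incl8 (x : Fin 8 → ℝ) : proj8 (incl8 x) = x := funext fun k => incl8_mid x k

/-- The action of the vectors of Minkowski space on `Cl₈ ⊕ Cl₈` that is given by the same block
matrices as the action on `Δ`, with the main involution in the role of the chirality operator. -/
def doubleCliffVec : Mink →ₗ[ℝ] Module.End ℝ (CliffordAlgebra quad8 × CliffordAlgebra quad8) :=
  LinearMap.mk₂ ℝ (fun v p =>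
    (v 10 • p.1 + v 9 • p.2 - CliffordAlgebra.ι quad8 (proj8 v) * p.2 -
        v 0 • CliffordAlgebra.involute p.2,
      v 9 • p.1 + CliffordAlgebra.ι quad8 (proj8 v) * p.1 +
        v 0 • CliffordAlgebra.involute p.1 - v 10 • p.2))
    (by
      intro v w p
      ext1 <;> simp only [Pi.add_apply, map_add, add_smul, add_mul, Prod.fst_add, Prod.snd_add] <;>
      abel)
    (by
      intro r v p
      ext1 <;> simp only [Pi.smul_apply, map_smul, smul_mul_assoc, Prod.smul_fst, Prod.smul_snd,
        smul_add, smul_sub, smul_eq_mul, mul_smul])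
    (by
      intro v p q
      ext1 <;> simp only [map_add, mul_add, smul_add, Prod.fst_add, Prod.snd_add] <;> abel)
    (by
      intro r v p
      ext1 <;> simp only [map_smul, mul_smul_comm, Prod.smul_fst, Prod.smul_snd, smul_add,
        smul_sub, smul_comm r])

theorem doubleCliffVec_apply (v : Mink) (a b : CliffordAlgebra quad8) :
    doubleCliffVec v (a, b) =
      (v 10 • a + v 9 • b - CliffordAlgebra.ι quad8 (proj8 v) * b -
        v 0 • CliffordAlgebra.involute b,
      v 9 • a + CliffordAlgebra.ι quad8 (proj8 v) * a +
        v 0 • CliffordAlgebra.involute a - v 10 • b) := rfl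

/-- The main involution squares to one and anticommutes with left multiplication by vectors, as
`Γ'₉` does with `Γ'ᵢ`, so all cross terms cancel. -/
theorem doubleCliffVec_sq (v : Mink) :
    doubleCliffVec v * doubleCliffVec v = algebraMap ℝ _ (quad11 v) := by
  have hq : quad11 v = -(v 0 * v 0) - quad8 (proj8 v) + v 9 * v 9 + v 10 * v 10 := by
    rw [quad11_apply, minkInner_eq, quad8_apply]
    simp only [proj8_apply]
    ring
  have hX : ∀ a, CliffordAlgebra.ι quad8 (proj8 v) * (CliffordAlgebra.ι quad8 (proj8 v) * a) =
      quad8 (proj8 v) • a := by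
    intro a
    rw [← mul_assoc, CliffordAlgebra.ι_sq_scalar, Algebra.smul_def]
  refine LinearMap.ext fun p => ?_
  obtain ⟨a, b⟩ := p
  rw [Module.End.mul_apply, doubleCliffVec_apply, doubleCliffVec_apply,
    Module.algebraMap_end_apply, hq]
  ext1 <;>
  simp only [map_add, map_sub, map_smul, map_mul, CliffordAlgebra.involute_ι,
    CliffordAlgebra.involute_involute, mul_add, mul_sub, mul_smul_comm, neg_mul, hX,
    Prod.smul_fst, Prod.smul_snd] <;>
  module

/-- The action of `Cl₁,₁₀` on `Cl₈ ⊕ Cl₈`. -/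
def doubleCliff : CliffordAlgebra quad11 →ₐ[ℝ]
    Module.End ℝ (CliffordAlgebra quad8 × CliffordAlgebra quad8) :=
  CliffordAlgebra.lift quad11 ⟨doubleCliffVec, doubleCliffVec_sq⟩

theorem doubleCliff_ι (v : Mink) :
    doubleCliff (CliffordAlgebra.ι quad11 v) = doubleCliffVec v :=
  CliffordAlgebra.lift_ι_apply _ _ v

/-- `e_♮` sends `(a, a)` to `(a, -a)`, and the sign in the first component of the action of `x`
turns this into `(x a, x a)`: the diagonal is the left regular module of `Cl₈`. -/
theorem doubleCliff_cliffEmb (x a : CliffordAlgebra quad8) :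
    doubleCliff (cliffEmb x) (a, a) = (x * a, x * a) := by
  induction x using CliffordAlgebra.induction generalizing a with
  | algebraMap r =>
    rw [AlgHom.commutes, AlgHom.commutes, Module.algebraMap_end_apply, ← Algebra.smul_def]
    rfl
  | ι x =>
    have h10 : proj8 (stdVec 10) = 0 := by
      funext k
      rw [proj8_apply, stdVec, Pi.single_eq_of_ne, Pi.zero_apply]
      rw [show (10 : Fin 11) = (Fin.last 9).succ from rfl]
      exact fun h => (Fin.castSucc_lt_last _).ne (Fin.succ_injective _ h)
    rw [cliffEmb_ι, map_mul, Module.End.mul_apply, doubleCliff_ι, doubleCliff_ι,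
      doubleCliffVec_apply, doubleCliffVec_apply, proj8_incl8, incl8_zero, incl8_nine, incl8_nat,
      h10, map_zero]
    simp [stdVec]
  | mul y z hy hz => rw [map_mul, map_mul, Module.End.mul_apply, hz, hy, mul_assoc]
  | add y z hy hz =>
    rw [map_add, map_add, LinearMap.add_apply, hy, hz, add_mul]
    rfl

/-- The left regular module is faithful, as evaluation at `(1, 1)` shows. Injectivity is what lets
relatedness descend from `G` to `K`. -/
theorem cliffEmb_injective : Function.Injective cliffEmb := by
  intro x y h
  have h2 := congrArg (fun z => (doubleCliff z (1, 1)).1) h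
  simpa only [doubleCliff_cliffEmb, mul_one] using h2

theorem spinEmb_coe (k : spinGroup quad8) :
    (spinEmb k : CliffordAlgebra quad11) = cliffEmb (k : CliffordAlgebra quad8) := rfl

theorem spinEmb_injective : Function.Injective spinEmb := by
  intro x y h
  exact Subtype.ext (cliffEmb_injective (congrArg Subtype.val h))

/-! ### The action of `Spin₈` on branes and on null rotations -/

/-- Such a `c` anticommutes with both factors of each generator `x e_♮` of the image. -/
theorem ι_mul_cliffEmb {c : Mink} (hc : ∀ x, minkInner (incl8 x) c = 0)
    (h10 : minkInner (stdVec 10) c = 0) (y : CliffordAlgebra quad8) :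
    CliffordAlgebra.ι quad11 c * cliffEmb y = cliffEmb y * CliffordAlgebra.ι quad11 c := by
  induction y using CliffordAlgebra.induction with
  | algebraMap r => rw [AlgHom.commutes, ← Algebra.commutes]
  | ι x =>
    have h1 : CliffordAlgebra.ι quad11 c * CliffordAlgebra.ι quad11 (incl8 x) = _ :=
      ι_mul_ι_swap quad11 (by rw [polar_quad11, hc, mul_zero])
    have h2 : CliffordAlgebra.ι quad11 c * CliffordAlgebra.ι quad11 (stdVec 10) = _ :=
      ι_mul_ι_swap quad11 (by rw [polar_quad11, h10, mul_zero])
    rw [cliffEmb_ι, ← mul_assoc, h1, neg_mul, mul_assoc, h2, mul_neg, neg_neg, mul_assoc]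
  | mul a b ha hb => rw [map_mul, ← mul_assoc, ha, mul_assoc, hb, mul_assoc]
  | add a b ha hb => rw [map_add, mul_add, add_mul, ha, hb]

theorem minkInner_incl8_stdVec_zero (x : Fin 8 → ℝ) : minkInner (incl8 x) (stdVec 0) = 0 := by
  rw [minkInner_comm, minkInner_stdVec, incl8_zero, mul_zero]

theorem minkInner_incl8_stdVec_nine (x : Fin 8 → ℝ) : minkInner (incl8 x) (stdVec 9) = 0 := by
  rw [minkInner_comm, minkInner_stdVec, incl8_nine, mul_zero]

theorem minkInner_stdVec_stdVec {M M' : Fin 11} (h : M ≠ M') :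
    minkInner (stdVec M) (stdVec M') = 0 := by
  rw [minkInner_stdVec, stdVec, Pi.single_eq_of_ne h, mul_zero]

theorem stdVec_zero_mul_cliffEmb (y : CliffordAlgebra quad8) :
    CliffordAlgebra.ι quad11 (stdVec 0) * cliffEmb y =
      cliffEmb y * CliffordAlgebra.ι quad11 (stdVec 0) :=
  ι_mul_cliffEmb minkInner_incl8_stdVec_zero (minkInner_stdVec_stdVec (by decide)) y

theorem stdVec_nine_mul_cliffEmb (y : CliffordAlgebra quad8) :
    CliffordAlgebra.ι quad11 (stdVec 9) * cliffEmb y =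
      cliffEmb y * CliffordAlgebra.ι quad11 (stdVec 9) :=
  ι_mul_cliffEmb minkInner_incl8_stdVec_nine (minkInner_stdVec_stdVec (by decide)) y

/-- The embedded element commutes with `e₀` and `e₉`, so conjugation touches only the factor coming
from `ζ`. -/
theorem brane_spinAct (k : spinGroup quad8) {ζ : ExteriorAlgebra ℝ (Fin 8 → ℝ)}
    (hζ : IsPlane8 ζ) :
    brane (spinAct quad8 k ζ) = spinAct quad11 (spinEmb k) (brane ζ) := by
  apply (toCliff quad11).injective
  rw [toCliff_brane (isPlane8_spinAct k hζ), toCliff_spinAct, toCliff_spinAct, toCliff_brane hζ,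
    ← map_inv, spinEmb_coe, spinEmb_coe, map_mul, map_mul]
  simp only [← mul_assoc]
  rw [mul_assoc _ (CliffordAlgebra.ι quad11 (stdVec 9)) (cliffEmb (k : CliffordAlgebra quad8)),
    stdVec_nine_mul_cliffEmb, ← mul_assoc, stdVec_zero_mul_cliffEmb]

theorem vecAct_spinEmb_of_orthogonal (k : spinGroup quad8) {c : Mink}
    (hc : ∀ x, minkInner (incl8 x) c = 0) (h10 : minkInner (stdVec 10) c = 0) :
    vecAct quad11 (spinEmb k) c = c := by
  rw [vecAct_eq_iff, spinEmb_coe, ι_mul_cliffEmb hc h10]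

theorem minkInner_vecAct (g : spinGroup quad11) (v w : Mink) :
    minkInner (vecAct quad11 g v) (vecAct quad11 g w) = minkInner v w := by
  have h := polar_vecAct quad11 g v w
  rw [polar_quad11, polar_quad11] at h
  linarith

theorem inE9_iff (c : Mink) :
    InE9 c ↔ minkInner (stdVec 0) c = 0 ∧ minkInner (stdVec 9) c = 0 := by
  rw [minkInner_stdVec, minkInner_stdVec, InE9, show minkSign 0 = -1 from rfl,
    show minkSign 9 = 1 from rfl, neg_one_mul, neg_eq_zero, one_mul]

/-- `𝔼⁹` is the orthogonal complement of `e₀` and `e₉`, both of which are fixed by rotations of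
`𝔼⁸`. -/
theorem InE9.vecAct_spinEmb (k : spinGroup quad8) {c : Mink} (hc : InE9 c) :
    InE9 (vecAct quad11 (spinEmb k) c) := by
  rw [inE9_iff] at hc ⊢
  have h0 : vecAct quad11 (spinEmb k) (stdVec 0) = stdVec 0 :=
    vecAct_spinEmb_of_orthogonal k minkInner_incl8_stdVec_zero
      (minkInner_stdVec_stdVec (by decide))
  have h9 : vecAct quad11 (spinEmb k) (stdVec 9) = stdVec 9 :=
    vecAct_spinEmb_of_orthogonal k minkInner_incl8_stdVec_nine
      (minkInner_stdVec_stdVec (by decide))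
  constructor
  · nth_rw 1 [← h0]
    rw [minkInner_vecAct, hc.1]
  · nth_rw 1 [← h9]
    rw [minkInner_vecAct, hc.2]

/-- Since `k` commutes with `e₊`, conjugating `c e₊` replaces `c` by its rotated image. -/
theorem conj_mem_nullRotations (k : spinGroup quad8) {r : spinGroup quad11}
    (hr : r ∈ nullRotations) : spinEmb k * r * (spinEmb k)⁻¹ ∈ nullRotations := by
  obtain ⟨c, hc, hr⟩ := hr
  refine ⟨vecAct quad11 (spinEmb k) c, hc.vecAct_spinEmb k, ?_⟩
  have hp : CliffordAlgebra.ι quad11 ePlus * ((spinEmb k)⁻¹ : spinGroup quad11) =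
      ((spinEmb k)⁻¹ : spinGroup quad11) * CliffordAlgebra.ι quad11 ePlus := by
    rw [← map_inv, spinEmb_coe, ePlus, map_add, add_mul, mul_add, stdVec_zero_mul_cliffEmb,
      stdVec_nine_mul_cliffEmb]
  rw [Submonoid.coe_mul, Submonoid.coe_mul, hr, nullRot, nullRot, mul_add, add_mul, mul_one,
    coe_mul_coe_inv, ι_vecAct, mul_smul_comm, smul_mul_assoc, mul_assoc, mul_assoc, hp]
  simp only [mul_assoc]

/-! ### Semidirect products and orbits -/

/-- `K` normalises `N`, so the product set is the join. The `N` factor stands on the left so that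
the `K` factor acts first and stays within the planes `π_ζ`. -/
theorem IsSemidirect.exists_mul {A : Type*} [Group A] {K N G : Subgroup A}
    (h : IsSemidirect K N G) {g : A} (hg : g ∈ G) : ∃ x ∈ N, ∃ k ∈ K, g = x * k := by
  have hs := Subgroup.coe_mul_of_right_le_normalizer_left N K
    (Subgroup.le_normalizer_iff.2 h.2.2)
  rw [sup_comm, h.1] at hs
  have hg' : g ∈ (G : Set A) := hg
  rw [hs] at hg'
  obtain ⟨x, hx, k, hk, e⟩ := Set.mem_mul.1 hg'
  exact ⟨x, hx, k, hk, e.symm⟩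

theorem sameOrbit_iff {V : Type*} [AddCommGroup V] [Module ℝ V] (Q : QuadraticForm ℝ V)
    {ι : Type*} (G : Subgroup (spinGroup Q)) (p : ι → ExteriorAlgebra ℝ V) (i₀ : ι) :
    SameOrbit Q G p ↔ ∀ i, ∃ g ∈ G, spinAct Q g (p i₀) = p i := by
  refine ⟨fun h i => h i₀ i, fun h i j => ?_⟩
  obtain ⟨g, hg, hgi⟩ := h i
  obtain ⟨g', hg', hgj⟩ := h j
  refine ⟨g' * g⁻¹, mul_mem hg' (inv_mem hg), ?_⟩
  rw [spinAct_mul, ← hgi, spinAct_inv_spinAct, hgj]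

theorem isPlane51_spinAct (g : spinGroup quad11) {p : ExteriorAlgebra ℝ Mink}
    (hp : IsPlane51 p) : IsPlane51 (spinAct quad11 g p) := by
  obtain ⟨v, hv, rfl⟩ := hp
  refine ⟨_, fun a b => ?_, spinAct_ιMulti quad11 g v (IsFrame51.polar_eq_zero hv)⟩
  rw [minkInner_vecAct, hv]

section Reduction

variable {K : Subgroup (spinGroup quad8)} {N G : Subgroup (spinGroup quad11)}

theorem spinEmb_mulVec (k : spinGroup quad8) (φ : Idx16 → ℝ) :
    (rho11 (spinEmb k : CliffordAlgebra quad11)).mulVec (spinorIncl φ) =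
      spinorIncl ((rho8 (k : CliffordAlgebra quad8)).mulVec φ) := by
  rw [spinEmb_coe, ← spinorIncl_mulVec]

theorem IsSemidirect.invariants_eq (hN : N ≤ nullRotations) (hN1 : N ≠ ⊥)
    (hG : IsSemidirect (K.map spinEmb) N G) :
    invariants rho11 G = (invariants rho8 K).map spinorIncl := by
  ext ε
  constructor
  · intro h
    have hN' : ε ∈ deltaPrime := by
      rw [← invariants_eq_deltaPrime hN hN1]
      exact fun g hg => h g (hG.1 ▸ Subgroup.mem_sup_right hg)
    rw [← range_spinorIncl] at hN'
    obtain ⟨φ, rfl⟩ := hN'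
    refine ⟨φ, fun k hk => spinorIncl_injective ?_, rfl⟩
    rw [← spinEmb_mulVec]
    exact h _ (hG.1 ▸ Subgroup.mem_sup_left ⟨k, hk, rfl⟩)
  · rintro ⟨φ, hφ, rfl⟩ g hg
    obtain ⟨x, hx, _, ⟨k, hk, rfl⟩, rfl⟩ := hG.exists_mul hg
    rw [Submonoid.coe_mul, map_mul, ← Matrix.mulVec_mulVec, spinEmb_mulVec, hφ k hk,
      nullRotations_mulVec (hN hx) (ePlus_mulVec_spinorIncl φ)]

theorem IsSemidirect.invariants_inf_susy (hN : N ≤ nullRotations) (hN1 : N ≠ ⊥)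
    (hG : IsSemidirect (K.map spinEmb) N G) {ζ : ExteriorAlgebra ℝ (Fin 8 → ℝ)}
    (hζ : IsPlane8 ζ) : invariants rho11 G ⊓ susy rho11 (brane ζ) =
      (invariants rho8 K ⊓ susy rho8 ζ).map spinorIncl := by
  rw [hG.invariants_eq hN hN1]
  ext ε
  constructor
  · rintro ⟨⟨φ, hφ, rfl⟩, h⟩
    exact ⟨φ, ⟨hφ, (mem_susy_brane_iff hζ φ).1 h⟩, rfl⟩
  · rintro ⟨φ, ⟨hφ, h⟩, rfl⟩
    exact ⟨⟨φ, hφ, rfl⟩, (mem_susy_brane_iff hζ φ).2 h⟩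

/-- The element `r_j k r_i⁻¹` does it. Only the join is assumed, not a semidirect product, so that
smaller subgroups `K'` with their joins can be inserted. -/
theorem sameOrbit_braneFamily (hG : K.map spinEmb ⊔ N = G) {ι : Type*}
    (r : ι → spinGroup quad11) (z : ι → ExteriorAlgebra ℝ (Fin 8 → ℝ))
    (hz : ∀ i, IsPlane8 (z i)) (hr : ∀ i, r i ∈ N) (h : SameOrbit quad8 K z) :
    SameOrbit quad11 G fun i => spinAct quad11 (r i) (brane (z i)) := by
  intro i j
  obtain ⟨k, hk, hkz⟩ := h i j
  have hNG : ∀ x ∈ N, x ∈ G := fun x hx => hG ▸ Subgroup.mem_sup_right hx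
  refine ⟨r j * spinEmb k * (r i)⁻¹, mul_mem (mul_mem (hNG _ (hr j))
    (hG ▸ Subgroup.mem_sup_left ⟨k, hk, rfl⟩)) (inv_mem (hNG _ (hr i))), ?_⟩
  simp only [spinAct_mul, spinAct_inv_spinAct]
  rw [← brane_spinAct k (hz i), hkz]

theorem exists_reduction (hG : IsSemidirect (K.map spinEmb) N G) {ι : Type*}
    {p : ι → ExteriorAlgebra ℝ Mink} {i₀ : ι} {ζ : ExteriorAlgebra ℝ (Fin 8 → ℝ)}
    (hp : SameOrbit quad11 G p) (h0 : p i₀ = brane ζ) :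
    ∃ (r : ι → spinGroup quad11) (k : ι → spinGroup quad8), k i₀ = 1 ∧
      ∀ i, r i ∈ N ∧ k i ∈ K ∧ p i = spinAct quad11 (r i * spinEmb (k i)) (brane ζ) := by
  have h : ∀ i, ∃ (r : spinGroup quad11) (k : spinGroup quad8), (i = i₀ → k = 1) ∧
      r ∈ N ∧ k ∈ K ∧ p i = spinAct quad11 (r * spinEmb k) (brane ζ) := by
    intro i
    -- The base index receives the trivial factorisation, so that the reduced family takes the value
    -- `ζ` there.
    by_cases hi : i = i₀
    · subst hi
      refine ⟨1, 1, fun _ => rfl, one_mem _, one_mem _, ?_⟩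
      rw [map_one, one_mul, spinAct_one, h0]
    · obtain ⟨g, hg, e⟩ := hp i₀ i
      obtain ⟨x, hx, _, ⟨k, hk, rfl⟩, rfl⟩ := hG.exists_mul hg
      exact ⟨x, k, fun e => absurd e hi, hx, hk, by rw [← e, h0]⟩
  choose r k h using h
  exact ⟨r, k, (h i₀).1 rfl, fun i => (h i).2⟩

/-- If `k ∈ K` factors as `x k'` with `x ∈ N`, `k' ∈ K'`, then `x = k k'⁻¹` lies in both `K` and
`N`, hence is trivial. -/
theorem IsSemidirect.eq_of_sup_eq (hG : IsSemidirect (K.map spinEmb) N G)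
    {K' : Subgroup (spinGroup quad8)} (hK' : K' ≤ K) (h : K'.map spinEmb ⊔ N = G) : K' = K := by
  refine le_antisymm hK' fun k hk => ?_
  have hG' : IsSemidirect (K'.map spinEmb) N G := ⟨h,
    le_bot_iff.1 (hG.2.1 ▸ inf_le_inf_right N (Subgroup.map_mono hK')),
    fun k hk => hG.2.2 k (Subgroup.map_mono hK' hk)⟩
  obtain ⟨x, hx, _, ⟨k', hk', rfl⟩, e⟩ := hG'.exists_mul
    (hG.1 ▸ Subgroup.mem_sup_left ⟨k, hk, rfl⟩ : spinEmb k ∈ G)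
  have hx' : x ∈ K.map spinEmb ⊓ N :=
    ⟨⟨k * k'⁻¹, mul_mem hk (inv_mem (hK' hk')), by
      rw [map_mul, map_inv, e, mul_inv_cancel_right]⟩, hx⟩
  rw [hG.2.1, Subgroup.mem_bot] at hx'
  rw [hx', one_mul] at e
  rwa [spinEmb_injective e]

end Reduction

/-! ### Minkowski geometry -/

theorem minkInner_add_left (x y z : Mink) :
    minkInner (x + y) z = minkInner x z + minkInner y z := by
  simp only [minkInner, Pi.add_apply, ← Finset.sum_add_distrib]
  exact Finset.sum_congr rfl fun M _ => by ring

theorem minkInner_smul_left (r : ℝ) (x z : Mink) :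
    minkInner (r • x) z = r * minkInner x z := by
  simp only [minkInner, Pi.smul_apply, smul_eq_mul, Finset.mul_sum]
  exact Finset.sum_congr rfl fun M _ => by ring

/-- The Minkowski inner product with a fixed vector, as a linear form. -/
def minkForm (z : Mink) : Mink →ₗ[ℝ] ℝ where
  toFun x := minkInner x z
  map_add' x y := minkInner_add_left x y z
  map_smul' r x := minkInner_smul_left r x z

theorem minkInner_sub_left (x y z : Mink) :
    minkInner (x - y) z = minkInner x z - minkInner y z := map_sub (minkForm z) x y

theorem minkInner_sum_left {κ : Type*} (s : Finset κ) (f : κ → Mink) (z : Mink) :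
    minkInner (∑ i ∈ s, f i) z = ∑ i ∈ s, minkInner (f i) z := map_sum (minkForm z) f s

theorem minkInner_add_right (x y z : Mink) :
    minkInner z (x + y) = minkInner z x + minkInner z y := by
  rw [minkInner_comm, minkInner_add_left, minkInner_comm x, minkInner_comm y]

theorem minkInner_sub_right (x y z : Mink) :
    minkInner z (x - y) = minkInner z x - minkInner z y := by
  rw [minkInner_comm, minkInner_sub_left, minkInner_comm x, minkInner_comm y]

theorem minkInner_smul_right (r : ℝ) (x z : Mink) :
    minkInner z (r • x) = r * minkInner z x := by
  rw [minkInner_comm, minkInner_smul_left, minkInner_comm]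

theorem minkInner_sum_right {κ : Type*} (s : Finset κ) (f : κ → Mink) (z : Mink) :
    minkInner z (∑ i ∈ s, f i) = ∑ i ∈ s, minkInner z (f i) := by
  rw [minkInner_comm, minkInner_sum_left]
  exact Finset.sum_congr rfl fun i _ => minkInner_comm _ _

theorem minkInner_eq_succ (x y : Mink) :
    minkInner x y = -(x 0 * y 0) + ∑ k : Fin 10, x k.succ * y k.succ := by
  rw [minkInner, Fin.sum_univ_succ]
  simp only [minkSign, Fin.cons_zero, Fin.cons_succ, one_mul, neg_mul]

/-- A null vector that is orthogonal to a timelike vector vanishes. -/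
theorem eq_zero_of_orthogonal_timelike {v b : Mink} (hv : minkInner v v = -1)
    (hvb : minkInner v b = 0) (hb : minkInner b b = 0) : b = 0 := by
  rw [minkInner_eq_succ] at hv hvb hb
  -- Cauchy–Schwarz for the spatial parts reads `(v₀ b₀)² ≤ (v₀² - 1) b₀²`, which forces `b₀ = 0`.
  have hcs := Finset.sum_mul_sq_le_sq_mul_sq Finset.univ (fun k : Fin 10 => v k.succ)
    fun k => b k.succ
  have e : ∀ f : Fin 10 → ℝ, ∑ k, f k ^ 2 = ∑ k, f k * f k := fun f => by simp only [sq]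
  rw [e, e, show ∑ k : Fin 10, v k.succ * b k.succ = v 0 * b 0 by linarith,
    show ∑ k : Fin 10, v k.succ * v k.succ = v 0 * v 0 - 1 by linarith,
    show ∑ k : Fin 10, b k.succ * b k.succ = b 0 * b 0 by linarith] at hcs
  have h0 : b 0 = 0 := by
    have : b 0 * b 0 ≤ 0 := by nlinarith
    exact mul_self_eq_zero.1 (le_antisymm this (mul_self_nonneg _))
  rw [h0, mul_zero, neg_zero, zero_add,
    Finset.sum_eq_zero_iff_of_nonneg fun _ _ => mul_self_nonneg _] at hb
  funext M
  induction M using Fin.cases with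
  | zero => exact h0
  | succ k => exact mul_self_eq_zero.1 (hb k (Finset.mem_univ k))

/-! ### Vectors tangent and normal to a plane, and the spinors it preserves -/

/-- Carrying `c` through the product collects one factor per vector; with signs `±1` this covers
both tangent and normal vectors. -/
theorem ι_mul_prod_ofFn {V : Type*} [AddCommGroup V] [Module ℝ V] (Q : QuadraticForm ℝ V) (c : V) :
    ∀ {m : ℕ} (v : Fin m → V) (s : Fin m → ℝ),
      (∀ i, CliffordAlgebra.ι Q c * CliffordAlgebra.ι Q (v i) =
        s i • (CliffordAlgebra.ι Q (v i) * CliffordAlgebra.ι Q c)) →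
      CliffordAlgebra.ι Q c * (List.ofFn fun i => CliffordAlgebra.ι Q (v i)).prod =
        (∏ i, s i) • ((List.ofFn fun i => CliffordAlgebra.ι Q (v i)).prod * CliffordAlgebra.ι Q c)
  | 0, v, s, _ => by simp
  | m + 1, v, s, h => by
    rw [List.ofFn_succ, List.prod_cons, ← mul_assoc, h 0, smul_mul_assoc, mul_assoc,
      ι_mul_prod_ofFn Q c (fun i => v i.succ) (fun i => s i.succ) fun i => h i.succ,
      Fin.prod_univ_succ, mul_smul_comm, smul_smul, mul_assoc]

/-- A vector orthogonal to all vectors of an orthogonal family of even size commutes with their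
product. -/
theorem ι_mul_toCliff_of_orthogonal {V : Type*} [AddCommGroup V] [Module ℝ V]
    (Q : QuadraticForm ℝ V) {m : ℕ} (hm : Even m) {v : Fin m → V}
    (h : ∀ i j, i ≠ j → QuadraticMap.polar Q (v i) (v j) = 0) {c : V}
    (hc : ∀ i, QuadraticMap.polar Q (v i) c = 0) :
    CliffordAlgebra.ι Q c * toCliff Q (ExteriorAlgebra.ιMulti ℝ m v) =
      toCliff Q (ExteriorAlgebra.ιMulti ℝ m v) * CliffordAlgebra.ι Q c := by
  rw [toCliff_ιMulti Q v h, ι_mul_prod_ofFn Q c v (fun _ => -1) fun i => by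
    rw [ι_mul_ι_swap Q (hc i), neg_one_smul]]
  rw [Finset.prod_const, Finset.card_univ, Fintype.card_fin, hm.neg_one_pow, one_smul]

/-- A vector in the span of an orthogonal family of even size anticommutes with their product. -/
theorem ι_mul_toCliff_of_sum {V : Type*} [AddCommGroup V] [Module ℝ V]
    (Q : QuadraticForm ℝ V) {m : ℕ} (hm : Even m) {v : Fin m → V}
    (h : ∀ i j, i ≠ j → QuadraticMap.polar Q (v i) (v j) = 0) (a : Fin m → ℝ) :
    CliffordAlgebra.ι Q (∑ i, a i • v i) * toCliff Q (ExteriorAlgebra.ιMulti ℝ m v) =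
      -(toCliff Q (ExteriorAlgebra.ιMulti ℝ m v) * CliffordAlgebra.ι Q (∑ i, a i • v i)) := by
  have key : ∀ j, CliffordAlgebra.ι Q (v j) * toCliff Q (ExteriorAlgebra.ιMulti ℝ m v) =
      -(toCliff Q (ExteriorAlgebra.ιMulti ℝ m v) * CliffordAlgebra.ι Q (v j)) := by
    intro j
    -- `v j` commutes with itself and anticommutes with the other `m - 1` vectors, an odd number.
    have hs : ∏ i, (if i = j then (1 : ℝ) else -1) = -1 := by
      rw [Finset.prod_ite, Finset.prod_const_one, one_mul, Finset.prod_const,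
        Finset.filter_ne' Finset.univ j, Finset.card_erase_of_mem (Finset.mem_univ j),
        Finset.card_univ, Fintype.card_fin]
      exact (Nat.Even.sub_odd (Fin.pos j) hm odd_one).neg_one_pow
    rw [toCliff_ιMulti Q v h, ι_mul_prod_ofFn Q (v j) v (fun i => if i = j then 1 else -1), hs,
      neg_one_smul]
    intro i
    split_ifs with hij
    · rw [hij, one_smul]
    · rw [ι_mul_ι_swap Q (h i j hij), neg_one_smul]
  rw [map_sum, Finset.sum_mul, Finset.mul_sum, ← Finset.sum_neg_distrib]
  refine Finset.sum_congr rfl fun j _ => ?_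
  rw [map_smul, smul_mul_assoc, key, mul_smul_comm, smul_neg]

/-- If `p · ε = s ε` for the product `p` of an orthogonal family of even size, and if
`(a + b) · ε = l ε` with `a` in the span of the family and `b` orthogonal to it, then
`a · ε = 0`. -/
theorem mulVec_sum_eq_zero {m : ℕ} (hm : Even m) {v : Fin m → Mink}
    (h : ∀ i j, i ≠ j → QuadraticMap.polar quad11 (v i) (v j) = 0) (a : Fin m → ℝ) {b : Mink}
    (hb : ∀ i, QuadraticMap.polar quad11 (v i) b = 0) {ε : Idx32 → ℝ} {s l : ℝ} (hs : s ≠ 0)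
    (hp : (rho11 (toCliff quad11 (ExteriorAlgebra.ιMulti ℝ m v))).mulVec ε = s • ε)
    (hab : (rho11 (CliffordAlgebra.ι quad11 (∑ i, a i • v i + b))).mulVec ε = l • ε) :
    (rho11 (CliffordAlgebra.ι quad11 (∑ i, a i • v i))).mulVec ε = 0 := by
  have h1 := congrArg (fun x => (rho11 x).mulVec ε) (ι_mul_toCliff_of_sum quad11 hm h a)
  have h2 := congrArg (fun x => (rho11 x).mulVec ε) (ι_mul_toCliff_of_orthogonal quad11 hm h hb)
  simp only [map_mul, map_neg, Matrix.neg_mulVec, ← Matrix.mulVec_mulVec, hp,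
    Matrix.mulVec_smul] at h1 h2
  rw [map_add, map_add, Matrix.add_mulVec] at hab
  -- Applying `p` to `a ε + b ε = l ε` gives `s (-a ε + b ε) = s l ε = s (a ε + b ε)`, hence `2 s a
  -- ε = 0`.
  have h3 := congrArg (rho11 (toCliff quad11 (ExteriorAlgebra.ιMulti ℝ m v))).mulVec hab
  rw [Matrix.mulVec_add, Matrix.mulVec_smul, hp, ← h2, ← neg_eq_iff_eq_neg.2 h1, smul_comm l,
    ← hab] at h3
  set A := (rho11 (CliffordAlgebra.ι quad11 (∑ i, a i • v i))).mulVec ε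
  have h4 : (2 * s) • A = 0 := by
    rw [smul_add] at h3
    have h5 := add_right_cancel h3
    rw [mul_smul, two_smul]
    nth_rw 1 [← h5]
    exact neg_add_cancel _
  exact (smul_eq_zero.1 h4).resolve_left (mul_ne_zero two_ne_zero hs)

theorem ePlus_zero : ePlus 0 = 1 := by
  simp [ePlus, stdVec]

theorem ePlus_nine : ePlus 9 = 1 := by
  simp [ePlus, stdVec]

theorem eMinus_zero : eMinus 0 = 1 := by
  simp [eMinus, stdVec]

theorem eMinus_nine : eMinus 9 = -1 := by
  simp [eMinus, stdVec]

theorem minkInner_ePlus (x : Mink) : minkInner ePlus x = -x 0 + x 9 := by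
  rw [ePlus, minkInner_add_left, minkInner_stdVec, minkInner_stdVec,
    show minkSign 0 = -1 from rfl, show minkSign 9 = 1 from rfl, neg_one_mul, one_mul]

theorem minkInner_eMinus (x : Mink) : minkInner eMinus x = -x 0 - x 9 := by
  rw [eMinus, minkInner_sub_left, minkInner_stdVec, minkInner_stdVec,
    show minkSign 0 = -1 from rfl, show minkSign 9 = 1 from rfl, neg_one_mul, one_mul]

/-- A plane that preserves a nonzero spinor annihilated by `e₊` contains `e₊`. -/
theorem ePlus_mem_span {v : Fin 6 → Mink} (hv : IsFrame51 v) {ε : Idx32 → ℝ} (hε : ε ≠ 0)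
    (hd : ε ∈ deltaPrime) (hp : ε ∈ susy rho11 (ExteriorAlgebra.ιMulti ℝ 6 v)) :
    ∃ a : Fin 6 → ℝ, ePlus = ∑ i, a i • v i := by
  -- Coefficients of the orthogonal projection to the plane; the sign accounts for the timelike
  -- basis vector.
  let a : Fin 6 → ℝ := fun i => (if i = 0 then -1 else 1) * minkInner (v i) ePlus
  refine ⟨a, ?_⟩
  set b := ePlus - ∑ i, a i • v i with hb
  have hvb : ∀ i, minkInner (v i) b = 0 := by
    intro i
    rw [hb, minkInner_sub_right, minkInner_sum_right]
    simp only [minkInner_smul_right, hv i, mul_ite, mul_zero, Finset.sum_ite_eq,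
      Finset.mem_univ, if_true, a]
    split_ifs <;> ring
  have hab : ∑ i, a i • v i + b = ePlus := add_sub_cancel _ _
  have hab0 : (rho11 (CliffordAlgebra.ι quad11 (∑ i, a i • v i + b))).mulVec ε =
      (0 : ℝ) • ε := by
    rw [hab, zero_smul]
    exact hd
  have hA := mulVec_sum_eq_zero (by decide) hv.polar_eq_zero a
    (fun i => by rw [polar_quad11, hvb, mul_zero]) one_ne_zero
    (by rw [one_smul]; exact hp) hab0
  rw [map_add, map_add, Matrix.add_mulVec, hA, zero_add, zero_smul] at hab0
  have hq := rho11_ι_mulVec_mulVec b ε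
  rw [hab0, Matrix.mulVec_zero] at hq
  -- The normal part `b` also annihilates `ε ≠ 0`, so it is null; being orthogonal to the timelike
  -- `v 0`, it vanishes.
  have hq0 := (smul_eq_zero.1 hq.symm).resolve_right hε
  rw [quad11_apply] at hq0
  have hb0 := eq_zero_of_orthogonal_timelike (by rw [hv, if_pos rfl, if_pos rfl]) (hvb 0) hq0
  rw [← hab, hb0, add_zero]

/-- Two orthonormal bases of a plane define the same multivector up to sign. -/
theorem ιMulti_eq_or_eq_neg {u v : Fin 6 → Mink} (hu : IsFrame51 u) (hv : IsFrame51 v)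
    (h : ∀ i, u i ∈ Submodule.span ℝ (Set.range v)) :
    ExteriorAlgebra.ιMulti ℝ 6 u = ExteriorAlgebra.ιMulti ℝ 6 v ∨
      ExteriorAlgebra.ιMulti ℝ 6 u = -ExteriorAlgebra.ιMulti ℝ 6 v := by
  choose A hA using fun i => (Submodule.mem_span_range_iff_exists_fun ℝ).1 (h i)
  let B : Matrix (Fin 6) (Fin 6) ℝ := Matrix.of A
  let D : Matrix (Fin 6) (Fin 6) ℝ := Matrix.diagonal fun i => if i = 0 then -1 else 1
  -- The change of basis is pseudo-orthogonal, so its determinant is `±1`.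
  have hBD : B * D * B.transpose = D := by
    ext i j
    have h1 := hu i j
    have hv' : ∀ k l, minkInner (v k) (v l) = _ := hv
    rw [← hA i, ← hA j, minkInner_sum_left] at h1
    simp only [minkInner_sum_right, minkInner_smul_left, minkInner_smul_right, hv', mul_ite,
      mul_zero, Finset.sum_ite_eq, Finset.mem_univ, if_true] at h1
    rw [Matrix.mul_apply, show D i j = if i = j then (if i = 0 then -1 else 1) else 0 from
      Matrix.diagonal_apply _ i j, ← h1]
    refine Finset.sum_congr rfl fun k _ => ?_
    rw [show (B * D) i k = A i k * if k = 0 then -1 else 1 from Matrix.mul_diagonal _ B i k,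
      Matrix.transpose_apply, show B j k = A j k from rfl]
    split_ifs <;> ring
  have hD : D.det ≠ 0 := by
    rw [Matrix.det_diagonal, Finset.prod_ne_zero_iff]
    intro i _
    split_ifs <;> norm_num
  have hdet := congrArg Matrix.det hBD
  rw [Matrix.det_mul, Matrix.det_mul, Matrix.det_transpose, mul_right_comm] at hdet
  have hdet' := mul_right_cancel₀ hD (hdet.trans (one_mul _).symm)
  have key := alternating_linearCombination (ExteriorAlgebra.ιMulti ℝ 6) v B
  rw [show (fun i => ∑ j, B i j • v j) = u from funext hA] at key
  rw [key]
  rcases mul_self_eq_one_iff.1 hdet' with e | e <;> rw [e]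
  · exact Or.inl (one_smul _ _)
  · exact Or.inr (neg_one_smul _ _)

/-- A plane that contains `e₊` has an orthonormal basis whose first two vectors sum to `e₊`. -/
theorem exists_adapted_frame {v : Fin 6 → Mink} (hv : IsFrame51 v) {a : Fin 6 → ℝ}
    (ha : ePlus = ∑ i, a i • v i) :
    ∃ u : Fin 6 → Mink, IsFrame51 u ∧ u 0 + u 1 = ePlus ∧
      ∀ i, u i ∈ Submodule.span ℝ (Set.range v) := by
  have hvs : ∀ i j, minkInner (v (Fin.succ i)) (v (Fin.succ j)) = if i = j then 1 else 0 := by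
    intro i j
    rw [hv]
    simp only [Fin.succ_inj, Fin.succ_ne_zero, if_false]
  have hv0 : ∀ i, minkInner (v 0) (v (Fin.succ i)) = 0 := fun i => by
    rw [hv, if_neg (Fin.succ_ne_zero i).symm]
  have hv00 : minkInner (v 0) (v 0) = -1 := by rw [hv, if_pos rfl, if_pos rfl]
  have hinner : ∀ x y : Fin 5 → ℝ, minkInner (∑ i, x i • v i.succ) (∑ i, y i • v i.succ) =
      ∑ i, x i * y i := by
    intro x y
    rw [minkInner_sum_left]
    simp only [minkInner_sum_right, minkInner_smul_left, minkInner_smul_right, hvs, mul_ite,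
      mul_zero, Finset.sum_ite_eq, Finset.mem_univ, if_true, mul_one]
    exact Finset.sum_congr rfl fun i _ => mul_comm _ _
  have hinner0 : ∀ x : Fin 5 → ℝ, minkInner (v 0) (∑ i, x i • v i.succ) = 0 := by
    intro x
    rw [minkInner_sum_right]
    exact Finset.sum_eq_zero fun i _ => by rw [minkInner_smul_right, hv0, mul_zero]
  have ha' : ePlus = a 0 • v 0 + ∑ i : Fin 5, a i.succ • v i.succ := by
    rw [ha, Fin.sum_univ_succ]
  have hnull : ∑ i : Fin 5, a i.succ * a i.succ = a 0 * a 0 := by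
    have h := quad11_ePlus
    rw [quad11_apply, ha', minkInner_add_left, minkInner_add_right, minkInner_add_right,
      hinner, minkInner_comm (∑ i : Fin 5, a i.succ • v i.succ)] at h
    simp only [minkInner_smul_left, minkInner_smul_right, hinner0, hv00] at h
    linarith
  have ha0 : a 0 ≠ 0 := by
    intro h0
    rw [h0, mul_zero, Finset.sum_eq_zero_iff_of_nonneg fun _ _ => mul_self_nonneg _] at hnull
    have h1 := congrFun ha' 0
    rw [ePlus_zero, h0, zero_smul, zero_add, Finset.sum_eq_zero] at h1
    · exact one_ne_zero h1
    · intro i hi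
      rw [mul_self_eq_zero.1 (hnull i hi), zero_smul]
  -- Nullness of `e₊` makes the rescaled spatial part a unit vector, so that `e₊ = a₀ (v₀ + t₀)`; it
  -- is then completed to an orthonormal basis.
  let t₀ : EuclideanSpace ℝ (Fin 5) := WithLp.toLp 2 fun i => (a 0)⁻¹ * a i.succ
  have ht₀ : ‖t₀‖ = 1 := by
    rw [EuclideanSpace.norm_eq, Real.sqrt_eq_one]
    simp only [t₀, Real.norm_eq_abs, sq_abs, mul_pow, ← Finset.mul_sum]
    simp only [sq, hnull]
    field_simp
  have hon : Orthonormal ℝ (({0} : Set (Fin 5)).domRestrict fun _ => t₀) := by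
    refine ⟨fun _ => ht₀, fun i j hij => absurd (Subsingleton.elim i j) hij⟩
  obtain ⟨e, he⟩ := hon.exists_orthonormalBasis_extension_of_card_eq (by simp)
  have he0 : e 0 = t₀ := he 0 rfl
  let t : Fin 5 → Mink := fun k => ∑ i, e k i • v i.succ
  have htt : ∀ k l, minkInner (t k) (t l) = if k = l then 1 else 0 := by
    intro k l
    rw [hinner, ← orthonormal_iff_ite.1 e.orthonormal k l, PiLp.inner_apply]
    exact Finset.sum_congr rfl fun i _ => by simp [mul_comm]
  have h0t : ∀ k, minkInner (v 0) (t k) = 0 := fun k => hinner0 _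
  have hpt : ePlus = a 0 • v 0 + a 0 • t 0 := by
    rw [ha']
    congr 1
    simp only [t, he0, t₀, Finset.smul_sum, smul_smul]
    exact Finset.sum_congr rfl fun i _ => by rw [mul_inv_cancel_left₀ ha0]
  -- Boost coefficients, determined by `α + β = a₀` and `α - β = a₀⁻¹`: then `α² - β² = 1`, and the
  -- boosted pair sums to `a₀ (v₀ + t₀) = e₊`.
  set α := (a 0 + (a 0)⁻¹) / 2 with hα
  set β := (a 0 - (a 0)⁻¹) / 2 with hβ
  have hαβ : α * α - β * β = 1 := by
    rw [hα, hβ]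
    field_simp
    ring
  have htv : ∀ k, minkInner (t k) (v 0) = 0 := fun k => by rw [minkInner_comm, h0t]
  refine ⟨Fin.cons (α • v 0 + β • t 0) (Fin.cons (β • v 0 + α • t 0) fun k => t k.succ),
    isFrame51_cons ?_ ?_ ?_ (fun k => ?_) (fun k => ?_) (fun k l => ?_), ?_, ?_⟩
  · simp only [minkInner_add_left, minkInner_add_right, minkInner_smul_left,
      minkInner_smul_right, hv00, h0t, htv, htt, if_true]
    linarith
  · simp only [minkInner_add_left, minkInner_add_right, minkInner_smul_left,
      minkInner_smul_right, hv00, h0t, htv, htt, if_true]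
    linarith
  · simp only [minkInner_add_left, minkInner_add_right, minkInner_smul_left,
      minkInner_smul_right, hv00, h0t, htv, htt, if_true]
    ring
  · simp only [minkInner_add_left, minkInner_smul_left, h0t, htt,
      if_neg (Fin.succ_ne_zero k).symm]
    ring
  · simp only [minkInner_add_left, minkInner_smul_left, h0t, htt,
      if_neg (Fin.succ_ne_zero k).symm]
    ring
  · rw [htt]
    simp only [Fin.succ_inj]
  · change α • v 0 + β • t 0 + (β • v 0 + α • t 0) = ePlus
    rw [hpt, show a 0 = α + β by rw [hα, hβ]; ring]
    module
  · have hvm : ∀ i, v i ∈ Submodule.span ℝ (Set.range v) := fun i =>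
      Submodule.subset_span ⟨i, rfl⟩
    have htm : ∀ k, t k ∈ Submodule.span ℝ (Set.range v) := fun k =>
      Submodule.sum_mem _ fun i _ => Submodule.smul_mem _ _ (hvm _)
    intro i
    induction i using Fin.cases with
    | zero => exact add_mem (Submodule.smul_mem _ _ (hvm _)) (Submodule.smul_mem _ _ (htm _))
    | succ i =>
      rw [Fin.cons_succ]
      induction i using Fin.cases with
      | zero => exact add_mem (Submodule.smul_mem _ _ (hvm _)) (Submodule.smul_mem _ _ (htm _))
      | succ i => exact htm _

/-! ### Planes that preserve the spinor `(ψ, 0)` -/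

theorem eMinus_mul_ePlus : CliffordAlgebra.ι quad11 eMinus * CliffordAlgebra.ι quad11 ePlus =
    algebraMap ℝ _ (-4) - CliffordAlgebra.ι quad11 ePlus * CliffordAlgebra.ι quad11 eMinus := by
  have h := CliffordAlgebra.ι_mul_ι_add_swap (Q := quad11) eMinus ePlus
  rw [polar_quad11, minkInner_eMinus, ePlus_zero, ePlus_nine] at h
  rw [eq_sub_iff_add_eq, h]
  norm_num

theorem InE9.eMinus_anti {c : Mink} (hc : InE9 c) :
    CliffordAlgebra.ι quad11 eMinus * CliffordAlgebra.ι quad11 c =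
      -(CliffordAlgebra.ι quad11 c * CliffordAlgebra.ι quad11 eMinus) :=
  ι_mul_ι_swap quad11 (by
    rw [polar_quad11, minkInner_comm, minkInner_eMinus, hc.1, hc.2]
    norm_num)

theorem nullRot_mul_ePlus {d : Mink} (hd : InE9 d) :
    nullRot d * CliffordAlgebra.ι quad11 ePlus = CliffordAlgebra.ι quad11 ePlus * nullRot d := by
  rw [nullRot, add_mul, mul_add, smul_mul_assoc, mul_smul_comm, mul_assoc, ePlus_sq,
    ← mul_assoc _ (CliffordAlgebra.ι quad11 d), ePlus_anti d hd, neg_mul, mul_assoc, ePlus_sq,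
    mul_zero, neg_zero, one_mul, mul_one]

/-- This is the action of a null rotation on `e₋`, in the shape wanted by `vecAct_eq_iff`. The
coefficient of `e₊` is the one that keeps the image null. -/
theorem nullRot_mul_eMinus {d : Mink} (hd : InE9 d) :
    nullRot d * CliffordAlgebra.ι quad11 eMinus =
      CliffordAlgebra.ι quad11 (eMinus - (2 : ℝ) • d + quad11 d • ePlus) * nullRot d := by
  have hpd := ePlus_anti d hd
  have hmd := hd.eMinus_anti
  have hmp := eMinus_mul_ePlus
  have hpp := ePlus_sq
  have hdd := CliffordAlgebra.ι_sq_scalar quad11 d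
  rw [nullRot, map_add, map_sub, map_smul, map_smul]
  set P := CliffordAlgebra.ι quad11 ePlus
  set M := CliffordAlgebra.ι quad11 eMinus
  set D := CliffordAlgebra.ι quad11 d
  have h1 : M * (D * P) = (4 : ℝ) • D + D * (P * M) := by
    rw [← mul_assoc, hmd, neg_mul, mul_assoc, hmp, mul_sub, ← Algebra.commutes,
      ← Algebra.smul_def]
    module
  have h2 : D * (D * P) = quad11 d • P := by
    rw [← mul_assoc, hdd, Algebra.smul_def]
  have h3 : P * (D * P) = 0 := by
    rw [← mul_assoc, hpd, neg_mul, mul_assoc, hpp, mul_zero, neg_zero]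
  simp only [mul_add, add_mul, sub_mul, mul_one, one_mul, smul_mul_assoc, mul_smul_comm, h1, h2,
    h3, mul_assoc, smul_zero]
  module

theorem nullRotation_coe {d : Mink} (hd : InE9 d) :
    ∃ r ∈ nullRotations, (r : CliffordAlgebra quad11) = nullRot d :=
  ⟨⟨nullRot d, nullRot_mem d hd⟩, ⟨d, hd, rfl⟩, rfl⟩

theorem stdVec_zero_eq : stdVec 0 = (1 / 2 : ℝ) • (ePlus + eMinus) := by
  rw [ePlus, eMinus]
  module

theorem stdVec_nine_eq : stdVec 9 = (1 / 2 : ℝ) • (ePlus - eMinus) := by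
  rw [ePlus, eMinus]
  module

/-- The null vectors `f` with `⟨e₊, f⟩ = ⟨e₊, e₋⟩` are the images of `e₋` under null rotations. -/
theorem exists_nullRot_eMinus {f : Mink} (hff : minkInner f f = 0) (hpf : minkInner ePlus f = -2) :
    ∃ d, InE9 d ∧ f = eMinus - (2 : ℝ) • d + quad11 d • ePlus := by
  have hpf' := hpf
  rw [minkInner_ePlus] at hpf'
  -- Solves the required equation for `d`: as `d` has no time component, comparing time components
  -- forces `quad11 d = f 0 - 1`.
  let d : Mink := (-1 / 2 : ℝ) • (f - eMinus - (f 0 - 1) • ePlus)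
  have hq : quad11 d = f 0 - 1 := by
    rw [quad11_apply]
    simp only [d, minkInner_smul_left, minkInner_smul_right, minkInner_sub_left,
      minkInner_sub_right, hff, minkInner_comm f, hpf, minkInner_eMinus, minkInner_ePlus,
      ePlus_zero, ePlus_nine, eMinus_zero, eMinus_nine]
    rw [show f 9 = f 0 - 2 by linarith]
    ring
  refine ⟨d, ⟨?_, ?_⟩, ?_⟩
  · simp only [d, Pi.smul_apply, Pi.sub_apply, smul_eq_mul, ePlus_zero, eMinus_zero]
    ring
  · simp only [d, Pi.smul_apply, Pi.sub_apply, smul_eq_mul, ePlus_nine, eMinus_nine]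
    linarith
  · rw [hq]
    simp only [d]
    module

/-- An orthonormal basis whose first two vectors sum to `e₊` is the image under a null rotation of
one that begins with `e₀, e₉`. -/
theorem exists_nullRotation_frame {u : Fin 6 → Mink} (hu : IsFrame51 u) (hp : u 0 + u 1 = ePlus) :
    ∃ r ∈ nullRotations, ∃ x : Fin 4 → Mink, (∀ a, InE9 (x a)) ∧ IsFrame51 (braneFrame x) ∧
      ExteriorAlgebra.ιMulti ℝ 6 u =
        spinAct quad11 r (ExteriorAlgebra.ιMulti ℝ 6 (braneFrame x)) := by
  have h00 : minkInner (u 0) (u 0) = -1 := by rw [hu, if_pos rfl, if_pos rfl]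
  have h11 : minkInner (u 1) (u 1) = 1 := by rw [hu, if_pos rfl, if_neg (by decide)]
  have h01 : minkInner (u 0) (u 1) = 0 := by rw [hu, if_neg (by decide)]
  have h10 : minkInner (u 1) (u 0) = 0 := by rw [hu, if_neg (by decide)]
  -- The null rotation fixes `e₊ = u₀ + u₁` and is chosen to send `e₋` to `u₀ - u₁`; half the sum
  -- and half the difference give `e₀ ↦ u₀` and `e₉ ↦ u₁`.
  obtain ⟨d, hd, hf⟩ := exists_nullRot_eMinus (f := u 0 - u 1)
    (by simp only [minkInner_sub_left, minkInner_sub_right, h00, h11, h01, h10]; norm_num)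
    (by
      rw [← hp]
      simp only [minkInner_add_left, minkInner_sub_right, h00, h11, h01, h10]
      norm_num)
  obtain ⟨r, hr, hrd⟩ := nullRotation_coe hd
  have hM := nullRot_mul_eMinus hd
  rw [← hf] at hM
  have hP := nullRot_mul_ePlus hd
  have hr0 : vecAct quad11 r (stdVec 0) = u 0 := by
    rw [vecAct_eq_iff, hrd, stdVec_zero_eq, map_smul, map_add, mul_smul_comm, mul_add, hM, hP,
      ← add_mul, ← map_add, ← smul_mul_assoc, ← map_smul, ← hp]
    congr 2
    module
  have hr9 : vecAct quad11 r (stdVec 9) = u 1 := by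
    rw [vecAct_eq_iff, hrd, stdVec_nine_eq, map_smul, map_sub, mul_smul_comm, mul_sub, hM, hP,
      ← sub_mul, ← map_sub, ← smul_mul_assoc, ← map_smul, ← hp]
    congr 2
    module
  let x : Fin 4 → Mink := fun a => vecAct quad11 r⁻¹ (u a.succ.succ)
  have hx : ∀ a, vecAct quad11 r (x a) = u a.succ.succ := fun a => vecAct_vecAct_inv quad11 r _
  have hx9 : ∀ a, InE9 (x a) := by
    intro a
    rw [inE9_iff, ← minkInner_vecAct r, ← minkInner_vecAct r (stdVec 9), hr0, hr9, hx, hu, hu]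
    exact ⟨if_neg (Fin.succ_ne_zero _).symm,
      if_neg fun e => (Fin.succ_ne_zero a) (Fin.succ_injective _ e).symm⟩
  have hfr : IsFrame51 (braneFrame x) := by
    refine isFrame51_braneFrame (fun a b => ?_) hx9
    rw [← minkInner_vecAct r, hx, hx, hu]
    simp only [Fin.succ_inj, Fin.succ_ne_zero, if_false]
  refine ⟨r, hr, x, hx9, hfr, ?_⟩
  rw [spinAct_ιMulti quad11 r _ hfr.polar_eq_zero]
  congr 1
  funext i
  induction i using Fin.cases with
  | zero => exact hr0.symm
  | succ i =>
    induction i using Fin.cases with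
    | zero => exact hr9.symm
    | succ i => exact (hx i).symm

theorem ePlus_mul_toCliff {x : Fin 4 → Mink}
    (hx : ∀ i j, i ≠ j → QuadraticMap.polar quad11 (x i) (x j) = 0) (h9 : ∀ a, InE9 (x a)) :
    CliffordAlgebra.ι quad11 ePlus * toCliff quad11 (ExteriorAlgebra.ιMulti ℝ 4 x) =
      toCliff quad11 (ExteriorAlgebra.ιMulti ℝ 4 x) * CliffordAlgebra.ι quad11 ePlus :=
  ι_mul_toCliff_of_orthogonal quad11 (by decide) hx fun i => by
    rw [polar_quad11, minkInner_comm, minkInner_ePlus, (h9 i).1, (h9 i).2, neg_zero, add_zero,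
      mul_zero]

/-- If `e₀ ∧ e₉ ∧ x₁ ∧ ⋯ ∧ x₄` preserves up to sign a spinor `ε` with `e_♮ · ε = ε`, then the vectors
`xᵢ` are orthogonal to `e_♮`. -/
theorem braneFrame_nat_eq_zero {x : Fin 4 → Mink} (hx : IsFrame51 (braneFrame x))
    (h9 : ∀ a, InE9 (x a)) {ε : Idx32 → ℝ} (hε : ε ≠ 0) (hd : ε ∈ deltaPrime)
    (hn : (rho11 (CliffordAlgebra.ι quad11 (stdVec 10))).mulVec ε = ε) {s : ℝ} (hs : s ≠ 0)
    (hp : (rho11 (toCliff quad11 (ExteriorAlgebra.ιMulti ℝ 6 (braneFrame x)))).mulVec ε = s • ε)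
    (k : Fin 4) : x k 10 = 0 := by
  have hxx : ∀ a b, minkInner (x a) (x b) = if a = b then 1 else 0 := by
    intro a b
    have h := hx a.succ.succ b.succ.succ
    simp only [Fin.succ_inj, Fin.succ_ne_zero, if_false] at h
    exact h
  have hxp : ∀ i j, i ≠ j → QuadraticMap.polar quad11 (x i) (x j) = 0 := by
    intro i j hij
    rw [polar_quad11, hxx, if_neg hij, mul_zero]
  -- The product of the `xᵢ` commutes with `e₊`, hence preserves `Δ'`, where `e₀ e₉` acts trivially
  -- and can be stripped off.
  have hY : (rho11 (toCliff quad11 (ExteriorAlgebra.ιMulti ℝ 4 x))).mulVec ε = s • ε := by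
    rw [← hp, toCliff_braneFrame hx, map_mul, map_mul, ← Matrix.mulVec_mulVec,
      ← Matrix.mulVec_mulVec, zero_nine_mulVec]
    rw [mem_deltaPrime, Matrix.mulVec_mulVec, ← map_mul, ePlus_mul_toCliff hxp h9, map_mul,
      ← Matrix.mulVec_mulVec, (mem_deltaPrime ε).1 hd, Matrix.mulVec_zero]
  set a : Mink := ∑ i, x i 10 • x i with ha
  have hxn : ∀ i, minkInner (x i) (stdVec 10) = x i 10 := by
    intro i
    rw [minkInner_comm, minkInner_stdVec, show minkSign 10 = 1 from rfl, one_mul]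
  have hxa : ∀ i, minkInner (x i) a = x i 10 := by
    intro i
    rw [ha, minkInner_sum_right]
    simp only [minkInner_smul_right, hxx, mul_ite, mul_one, mul_zero, Finset.sum_ite_eq,
      Finset.mem_univ, if_true]
  have hA : (rho11 (CliffordAlgebra.ι quad11 a)).mulVec ε = 0 :=
    mulVec_sum_eq_zero (by decide) hxp (fun i => x i 10) (b := stdVec 10 - a) (l := 1)
      (fun i => by rw [polar_quad11, minkInner_sub_right, hxn, hxa, sub_self, mul_zero]) hs hY
      (by rw [← ha, add_sub_cancel, hn, one_smul])
  have hq := rho11_ι_mulVec_mulVec a ε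
  rw [hA, Matrix.mulVec_zero] at hq
  have ha9 : InE9 a := by
    constructor <;> rw [ha, Finset.sum_apply] <;> refine Finset.sum_eq_zero fun i _ => ?_
    · rw [Pi.smul_apply, (h9 i).1, smul_zero]
    · rw [Pi.smul_apply, (h9 i).2, smul_zero]
  have ha0 := ha9.eq_zero_of_quad11 ((smul_eq_zero.1 hq.symm).resolve_right hε)
  rw [← hxa k, ha0, minkInner_comm]
  exact map_zero (minkForm (x k))

theorem incl8_proj8 {c : Mink} (hc : InE9 c) (h10 : c 10 = 0) : incl8 (proj8 c) = c := by
  funext M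
  rcases index_cases M with rfl | ⟨k, rfl⟩ | rfl | rfl
  · rw [incl8_zero, hc.1]
  · rw [incl8_mid, proj8_apply]
  · exact (incl8_nine _).trans hc.2.symm
  · exact (incl8_nat _).trans h10.symm

theorem IsPlane8.neg {ζ : ExteriorAlgebra ℝ (Fin 8 → ℝ)} (hζ : IsPlane8 ζ) : IsPlane8 (-ζ) := by
  obtain ⟨w, hw, rfl⟩ := hζ
  refine ⟨Function.update w 0 (-w 0), fun a b => ?_, ?_⟩
  · have h := hw a b
    by_cases ha : a = 0 <;> by_cases hb : b = 0
    · subst ha hb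
      simpa using h
    · subst ha
      rw [Function.update_self, Function.update_of_ne hb, ← h.trans (if_neg (Ne.symm hb))]
      simp [h, Ne.symm hb]
    · subst hb
      rw [Function.update_self, Function.update_of_ne ha]
      simp [h, ha]
    · rw [Function.update_of_ne ha, Function.update_of_ne hb, h]
  · rw [AlternatingMap.map_update_neg, Function.update_eq_self]

theorem brane_neg (ζ : ExteriorAlgebra ℝ (Fin 8 → ℝ)) : brane (-ζ) = -brane ζ := by
  rw [brane, brane, map_neg, mul_neg, smul_neg]

/-- Negative chirality puts the image entirely in the upper block, where `Γ_♮` is `1`. This is what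
confines the 4-plane to `𝔼⁸` instead of `𝔼⁹`. -/
theorem spinorIncl_of_negative {ψ : Idx16 → ℝ} (hψ : chir8.mulVec ψ = -ψ) :
    (rho11 (CliffordAlgebra.ι quad11 (stdVec 10))).mulVec (spinorIncl ψ) = spinorIncl ψ := by
  rw [rho11_stdVec, show (10 : Fin 11) = (Fin.last 9).succ from rfl, gamma11_nat,
    spinorIncl_apply, hψ, Matrix.fromBlocks_mulVec]
  simp

/-- A `(5,1)`-plane that preserves `(ψ, 0)` is a null-rotated Cayley plane. -/
theorem exists_brane_of_mem_susy {ψ : Idx16 → ℝ} (hψ : ψ ≠ 0) (hψc : chir8.mulVec ψ = -ψ)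
    {p : ExteriorAlgebra ℝ Mink} (hp : IsPlane51 p) (hs : spinorIncl ψ ∈ susy rho11 p) :
    ∃ r ∈ nullRotations, ∃ ζ, IsPlane8 ζ ∧ p = spinAct quad11 r (brane ζ) ∧
      ψ ∈ susy rho8 ζ := by
  have hε : spinorIncl ψ ≠ 0 := fun e => hψ (spinorIncl_injective (e.trans (map_zero _).symm))
  have hd : spinorIncl ψ ∈ deltaPrime := ePlus_mulVec_spinorIncl ψ
  obtain ⟨v, hv, rfl⟩ := hp
  obtain ⟨a, ha⟩ := ePlus_mem_span hv hε hd hs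
  obtain ⟨u, hu, hup, huv⟩ := exists_adapted_frame hv ha
  obtain ⟨r, hr, x, h9, hx, hux⟩ := exists_nullRotation_frame hu hup
  -- The adapted frame may have the opposite orientation; the sign is carried along and finally
  -- absorbed into the orientation of `ζ`.
  have hsign : ∃ s : ℝ, (s = 1 ∨ s = -1) ∧ ExteriorAlgebra.ιMulti ℝ 6 v =
      spinAct quad11 r (s • ExteriorAlgebra.ιMulti ℝ 6 (braneFrame x)) := by
    rcases ιMulti_eq_or_eq_neg hu hv huv with e | e
    · exact ⟨1, Or.inl rfl, by rw [← e, hux, one_smul]⟩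
    · exact ⟨-1, Or.inr rfl, by rw [neg_one_smul, spinAct_neg, ← hux, e, neg_neg]⟩
  obtain ⟨s, hs1, hvx⟩ := hsign
  have hss : s * s = 1 := by rcases hs1 with rfl | rfl <;> norm_num
  have hfix := nullRotations_mulVec hr hd
  have hs' := hs
  rw [hvx, mem_susy_spinAct rho11 r _ hfix, mem_susy, map_smul, map_smul,
    Matrix.smul_mulVec] at hs'
  have hpx : (rho11 (toCliff quad11 (ExteriorAlgebra.ιMulti ℝ 6 (braneFrame x)))).mulVec
      (spinorIncl ψ) = s • spinorIncl ψ := by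
    conv_rhs => rw [← hs', smul_smul, hss, one_smul]
  have hnat := braneFrame_nat_eq_zero hx h9 hε hd (spinorIncl_of_negative hψc)
    (left_ne_zero_of_mul_eq_one hss) hpx
  let w : Fin 4 → Fin 8 → ℝ := fun i => proj8 (x i)
  have hwx : ∀ i, incl8 (w i) = x i := fun i => incl8_proj8 (h9 i) (hnat i)
  have hw : IsFrame8 w := by
    intro i j
    have h := hx i.succ.succ j.succ.succ
    simp only [Fin.succ_inj, Fin.succ_ne_zero, if_false] at h
    rw [← h, ← minkInner_incl8, hwx, hwx]
    rfl
  have hbw : ExteriorAlgebra.ιMulti ℝ 6 (braneFrame x) =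
      brane (ExteriorAlgebra.ιMulti ℝ 4 w) := by
    rw [brane_ιMulti]
    simp only [hwx]
  have hw8 : IsPlane8 (ExteriorAlgebra.ιMulti ℝ 4 w) := ⟨w, hw, rfl⟩
  have main : ∃ ζ, IsPlane8 ζ ∧ s • ExteriorAlgebra.ιMulti ℝ 6 (braneFrame x) = brane ζ := by
    rcases hs1 with rfl | rfl
    · exact ⟨_, hw8, by rw [one_smul, hbw]⟩
    · exact ⟨_, hw8.neg, by rw [neg_one_smul, hbw, brane_neg]⟩
  obtain ⟨ζ, hζ, hζs⟩ := main
  refine ⟨r, hr, ζ, hζ, by rw [hvx, hζs], ?_⟩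
  rw [← mem_susy_brane_iff hζ, ← hζs, ← mem_susy_spinAct rho11 r _ hfix, ← hvx]
  exact hs

end

/-! ### The reduction of `G`-families of branes to `K`-families of calibrated planes -/

theorem mainTheorem3 {ι : Type*}
    -- a nonzero `Cl₈` spinor of negative chirality, whose isotropy group in `Spin₈` is `Spin₇`
    (ψ : Idx16 → ℝ) (hψ : ψ ≠ 0) (hψc : chir8.mulVec ψ = -ψ)
    -- `G = K ⋉ N` with `K ⊂ Spin₇`, `N ⊂ ℝ⁹` and `N` nontrivial
    (K : Subgroup (spinGroup quad8)) (hK : K ≤ spinorStabilizer rho8 ψ)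
    (N : Subgroup (spinGroup quad11)) (hN : N ≤ nullRotations) (hN1 : N ≠ ⊥)
    (G : Subgroup (spinGroup quad11)) (hG : IsSemidirect (K.map spinEmb) N G) :
    -- `Δ' = ker Γ₊ = Δ^N` is sixteen-dimensional, and it is the `Cl₈` spinor module
    (invariants rho11 N = deltaPrime ∧
      Module.finrank ℝ deltaPrime = 16 ∧
      Function.Injective spinorIncl ∧
      LinearMap.range spinorIncl = deltaPrime ∧
      ∀ (x : CliffordAlgebra quad8) (φ : Idx16 → ℝ),
        spinorIncl ((rho8 x).mulVec φ) = (rho11 (cliffEmb x)).mulVec (spinorIncl φ)) ∧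
    -- `π = -½ e₊ ∧ e₋ ∧ ζ` is a `(5,1)`-plane with `Δ^G ∩ Δ(π) = (Δ')^K ∩ Δ'(ζ)`
    (∀ ζ, IsPlane8 ζ →
      IsPlane51 (brane ζ) ∧
      invariants rho11 G ⊓ susy rho11 (brane ζ) =
        (invariants rho8 K ⊓ susy rho8 ζ).map spinorIncl) ∧
    -- `ζ · φ = φ` if and only if `ζ` is calibrated by the form built by squaring `φ`
    (∀ ζ, IsPlane8 ζ → ∀ φ : Idx16 → ℝ, φ ≠ 0 →
      (φ ∈ susy rho8 ζ ↔ IsCalibrated (cayleyForm φ) ζ)) ∧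
    -- families of planes in the `G`-orbit of `π` are null-rotated families in the `K`-orbit of `ζ`
    (∀ ζ, IsPlane8 ζ → ∀ (p : ι → ExteriorAlgebra ℝ Mink) (i₀ : ι), p i₀ = brane ζ →
      SameOrbit quad11 G p →
      (∃ (r : ι → spinGroup quad11) (z : ι → ExteriorAlgebra ℝ (Fin 8 → ℝ)),
        z i₀ = ζ ∧
        (∀ i, r i ∈ N ∧ IsPlane8 (z i) ∧ p i = spinAct quad11 (r i) (brane (z i))) ∧
        SameOrbit quad8 K z ∧
        (Related quad11 G p → Related quad8 K z) ∧
        ∀ φ ∈ invariants rho8 K ⊓ susy rho8 ζ, φ ≠ 0 → ∀ i, IsCalibrated (cayleyForm φ) (z i)) ∧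
      (∀ i, IsPlane51 (p i)) ∧
      invariants rho11 G ⊓ susy rho11 (brane ζ) ≤ ⨅ i, susy rho11 (p i) ∧
      (invariants rho11 G ⊓ susy rho11 (brane ζ) ≠ ⊥ →
        ∃ φ ∈ invariants rho8 K ⊓ susy rho8 ζ, φ ≠ 0 ∧
          (chir8.mulVec φ = φ ∨ chir8.mulVec φ = -φ))) ∧
    -- and conversely
    (∀ ζ, IsPlane8 ζ → ∀ (r : ι → spinGroup quad11) (z : ι → ExteriorAlgebra ℝ (Fin 8 → ℝ))
      (i₀ : ι), z i₀ = ζ → (∀ i, r i ∈ N) → SameOrbit quad8 K z →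
      SameOrbit quad11 G (fun i => spinAct quad11 (r i) (brane (z i)))) ∧
    -- every family of `(5,1)`-planes in one `G`-orbit which preserves the invariant spinor
    -- `(ψ, 0)` consists of null-rotated Cayley planes in one `K`-orbit
    (∀ (p : ι → ExteriorAlgebra ℝ Mink) (i₀ : ι), IsPlane51 (p i₀) → SameOrbit quad11 G p →
      spinorIncl ψ ∈ susy rho11 (p i₀) →
      ∃ (r : ι → spinGroup quad11) (z : ι → ExteriorAlgebra ℝ (Fin 8 → ℝ)),
        SameOrbit quad8 K z ∧
        ∀ i, r i ∈ nullRotations ∧ IsCalibrated (cayleyForm ψ) (z i) ∧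
          p i = spinAct quad11 (r i) (brane (z i))) := by
  have horb : ∀ (ζ : ExteriorAlgebra ℝ (Fin 8 → ℝ)) (k : ι → spinGroup quad8) (i₀ : ι),
      spinAct quad8 (k i₀) ζ = ζ → (∀ i, k i ∈ K) →
      SameOrbit quad8 K fun i => spinAct quad8 (k i) ζ := fun ζ k i₀ h0 hk =>
    (sameOrbit_iff quad8 K _ i₀).2 fun i => ⟨k i, hk i, by rw [h0]⟩
  refine ⟨⟨invariants_eq_deltaPrime hN hN1, finrank_deltaPrime, spinorIncl_injective,
      range_spinorIncl, spinorIncl_mulVec⟩,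
    fun ζ hζ => ⟨isPlane51_brane hζ, hG.invariants_inf_susy hN hN1 hζ⟩,
    fun ζ hζ φ hφ => mem_susy_iff_isCalibrated hζ hφ, ?_, ?_, ?_⟩
  · intro ζ hζ p i₀ h0 hp
    obtain ⟨r, k, hk1, hrk⟩ := exists_reduction hG hp h0
    have hz0 : spinAct quad8 (k i₀) ζ = ζ := by rw [hk1, spinAct_one]
    have hz : ∀ i, IsPlane8 (spinAct quad8 (k i) ζ) := fun i => isPlane8_spinAct (k i) hζ
    have hpz : ∀ i, p i = spinAct quad11 (r i) (brane (spinAct quad8 (k i) ζ)) := by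
      intro i
      rw [(hrk i).2.2, spinAct_mul, brane_spinAct (k i) hζ]
    refine ⟨⟨r, fun i => spinAct quad8 (k i) ζ, hz0, fun i => ⟨(hrk i).1, hz i, hpz i⟩,
      horb ζ k i₀ hz0 fun i => (hrk i).2.1, fun hrel => ⟨horb ζ k i₀ hz0 fun i => (hrk i).2.1,
        fun K' hK' hzK' => ?_⟩, fun φ hφ h i => ?_⟩, fun i => ?_, le_iInf fun i ε hε => ?_,
      fun h => exists_chiral hζ fun e => h ?_⟩
    -- If `K'` already relates the reduced planes, its join with `N` relates the original ones;
    -- minimality makes that join `G`, and semidirectness then gives `K' = K`.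
    · have hp' := sameOrbit_braneFamily (rfl : K'.map spinEmb ⊔ N = _) r _ hz
        (fun i => (hrk i).1) hzK'
      rw [← show p = _ from funext hpz] at hp'
      exact hG.eq_of_sup_eq hK'
        (hrel.2 _ (hG.1 ▸ sup_le_sup_right (Subgroup.map_mono hK') N) hp')
    · rw [← mem_susy_iff_isCalibrated (hz i) h,
        mem_susy_spinAct rho8 (k i) ζ (hφ.1 (k i) (hrk i).2.1)]
      exact hφ.2
    · rw [hpz i]
      exact isPlane51_spinAct _ (isPlane51_brane (hz i))
    · obtain ⟨g, hg, hgp⟩ := hp i₀ i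
      rw [← hgp, h0, mem_susy_spinAct rho11 g _ (hε.1 g hg)]
      exact hε.2
    · rw [hG.invariants_inf_susy hN hN1 hζ, e, Submodule.map_bot]
  · intro ζ hζ r z i₀ h0 hr hz
    refine sameOrbit_braneFamily hG.1 r z (fun i => ?_) hr hz
    obtain ⟨k, -, hk⟩ := hz i₀ i
    rw [← hk, h0]
    exact isPlane8_spinAct k hζ
  · intro p i₀ hp0 hp hs
    obtain ⟨r₀, hr₀, ζ, hζ, hpζ, hψζ⟩ := exists_brane_of_mem_susy hψ hψc hp0 hs
    have hex : ∀ i, ∃ x ∈ N, ∃ k ∈ K, p i = spinAct quad11 (x * spinEmb k) (p i₀) := by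
      intro i
      obtain ⟨g, hg, e⟩ := hp i₀ i
      obtain ⟨x, hx, _, ⟨k, hk, rfl⟩, rfl⟩ := hG.exists_mul hg
      exact ⟨x, hx, k, hk, e.symm⟩
    choose x hx k hk hpk using hex
    -- Rewrite `x k r₀` as `x (k r₀ k⁻¹) k`, with the null rotations on the left. As `r₀` comes from
    -- the plane and need not lie in `N`, the result is only known to lie in `ℝ⁹`.
    refine ⟨fun i => x i * (spinEmb (k i) * r₀ * (spinEmb (k i))⁻¹),
      fun i => spinAct quad8 (k i) ζ, fun i j => ?_, fun i => ⟨?_, ?_, ?_⟩⟩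
    · refine ⟨k j * (k i)⁻¹, mul_mem (hk j) (inv_mem (hk i)), ?_⟩
      rw [spinAct_mul, spinAct_inv_spinAct]
    · exact mul_mem (hN (hx i)) (conj_mem_nullRotations _ hr₀)
    · rw [← mem_susy_iff_isCalibrated (isPlane8_spinAct _ hζ) hψ,
        mem_susy_spinAct rho8 _ ζ (hK (hk i))]
      exact hψζ
    · rw [brane_spinAct _ hζ, ← spinAct_mul, hpk i, hpζ, ← spinAct_mul]
      congr 1
      group
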